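/- Let $N>1$ be an integer and let $m,r_0>0$. Put $$\alpha_N=\frac1{16}\sum_{k=1}^{2N-1}\frac{((-1)^k-1)^2}{\sin^3(k\pi/2N)},\qquad \gamma_N=\frac14\sum_{k=1}^{2N-1}\frac1{\sin(k\pi/2N)},$$ $$f(r,d)=\sum_{k=1}^{2N-1}\frac{\sin^2(k\pi/2N)}{\left[4r^2\sin^2(k\pi/2N)+((-1)^k-1)^2d^2\right]^{3/2}},\qquad g(r,d)=\sum_{k=1}^{2N-1}\frac{((-1)^k-1)^2}{\left[4r^2\sin^2(k\pi/2N)+((-1)^k-1)^2d^2\right]^{3/2}}.$$ For real $a,b$ let $r(t)=R(a,b,t)>0$, $d(t)=D(a,b,t)$, $\theta(t)=\Theta(a,b,t)$ denote the solution of $$\ddot r=\frac{a^2}{r^3}-2rm\,f(r,d),\qquad \ddot d=-\frac{m\,d}{2}\,g(r,d),\qquad \dot\theta=\frac{a}{r^2},$$ $$r(0)=r_0,\quad \dot r(0)=0,\quad d(0)=0,\quad \dot d(0)=b,\quad \theta(0)=0.$$ Then there are $\hat b>0$ and continuous functions $a,T:(-\hat b,\hat b)\to\mathbb R$ with $T>0$,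 $$a(0)=\sqrt{m\gamma_N r_0},\qquad T(0)=\frac{\pi}{2}\sqrt{\frac{r_0^3}{m\alpha_N}},$$ such that for every $b\in(-\hat b,\hat b)$ the solution with parameters $(a(b),b)$ exists for all times and is unique, and $r=R(a(b),b,\cdot)$, $d=D(a(b),b,\cdot)$, $\theta=\Theta(a(b),b,\cdot)$ satisfy: 1. $(a(b),b,T(b))$ solves the system (I): $R_t(a(b),b,T(b))=0$ and $D_t(a(b),b,T(b))=0$. 2. $r$ and $d$ are $4T(b)$-periodic. 3. (Double symmetry) $r$ is even, $d$ is odd, and both are even with respect to $t=T(b)$, that is, $r(T(b)-t)=r(T(b)+t)$ and $d(T(b)-t)=d(T(b)+t)$ for all $t$. 4. (Hip-hop solution) The $2N$ bodies $\mathbf r_j(t)=\mathcal R^{\,j-1}\big(r(t)\cos\theta(t),\,r(t)\sin\theta(t),\,d(t)\big)^{\mathsf T}$, $j=1,\dots,2N$, where $\mathcal R$ is the rotation by $\pi/N$ about the $z$-axis composed with the reflection in the plane $z=0$, never collide and solve Newton's equations of the $2N$-body problem with all masses equal to $m$ and gravitational constant $1$. 5. For $b=0$ the solution is the planar circular one: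 $r\equiv r_0$ and $d\equiv 0$. -/

import Mathlib

open scoped Matrix

noncomputable section

/-- The sum `f(r, d)` in the radial equation of the antiprism `2N`-body problem. -/
def hipHopF (N : ℕ) (r d : ℝ) : ℝ :=
  ∑ k ∈ Finset.Icc 1 (2 * N - 1),
    Real.sin (k * Real.pi / (2 * N)) ^ 2 /
      (4 * r ^ 2 * Real.sin (k * Real.pi / (2 * N)) ^ 2
        + ((-1 : ℝ) ^ k - 1) ^ 2 * d ^ 2) ^ (3 / 2 : ℝ)

/-- The sum `g(r, d)` in the vertical equation of the antiprism `2N`-body problem. -/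
def hipHopG (N : ℕ) (r d : ℝ) : ℝ :=
  ∑ k ∈ Finset.Icc 1 (2 * N - 1),
    ((-1 : ℝ) ^ k - 1) ^ 2 /
      (4 * r ^ 2 * Real.sin (k * Real.pi / (2 * N)) ^ 2
        + ((-1 : ℝ) ^ k - 1) ^ 2 * d ^ 2) ^ (3 / 2 : ℝ)

/-- The constant `α_N`. -/
def hipHopAlpha (N : ℕ) : ℝ :=
  1 / 16 * ∑ k ∈ Finset.Icc 1 (2 * N - 1),
    ((-1 : ℝ) ^ k - 1) ^ 2 / Real.sin (k * Real.pi / (2 * N)) ^ 3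

/-- The constant `γ_N`. -/
def hipHopGamma (N : ℕ) : ℝ :=
  1 / 4 * ∑ k ∈ Finset.Icc 1 (2 * N - 1), 1 / Real.sin (k * Real.pi / (2 * N))

/-- `(r, d, θ)`, defined for all times, solves the cylindrical equations of motion
`r'' = a² / r³ - 2 r m f(r, d)`, `d'' = -(m d / 2) g(r, d)`, `θ' = a / r²`
with `r(0) = r₀`, `r'(0) = 0`, `d(0) = 0`, `d'(0) = b`, `θ(0) = 0`
(and stays in the domain `r > 0` of these equations). -/
structure IsHipHopMotion (N : ℕ) (m r₀ a b : ℝ) (r d θ : ℝ → ℝ) : Prop where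
  r_pos : ∀ t, 0 < r t
  differentiable_r : Differentiable ℝ r
  differentiable_d : Differentiable ℝ d
  ode_r : ∀ t, HasDerivAt (deriv r) (a ^ 2 / r t ^ 3 - 2 * r t * m * hipHopF N (r t) (d t)) t
  ode_d : ∀ t, HasDerivAt (deriv d) (-(m * d t / 2) * hipHopG N (r t) (d t)) t
  ode_θ : ∀ t, HasDerivAt θ (a / r t ^ 2) t
  r_zero : r 0 = r₀
  deriv_r_zero : deriv r 0 = 0
  d_zero : d 0 = 0
  deriv_d_zero : deriv d 0 = b
  θ_zero : θ 0 = 0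

/-- The rotation by `π / N` about the `z`-axis composed with the reflection in `z = 0`. -/
def antiprismMatrix (N : ℕ) : Matrix (Fin 3) (Fin 3) ℝ :=
  !![Real.cos (Real.pi / N), -Real.sin (Real.pi / N), 0;
     Real.sin (Real.pi / N), Real.cos (Real.pi / N), 0;
     0, 0, -1]

/-- The antiprism configuration: body `0` has cylindrical coordinates `(r, θ, d)`, and body `j`
is its image under the `j`-th power of `antiprismMatrix N`. -/
def antiprismBody (N : ℕ) (r d θ : ℝ → ℝ) (j : Fin (2 * N)) (t : ℝ) :
    EuclideanSpace ℝ (Fin 3) :=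
  WithLp.toLp 2 ((antiprismMatrix N ^ (j : ℕ)) *ᵥ
    ![r t * Real.cos (θ t), r t * Real.sin (θ t), d t])

/-- Collision-free solutions, for all times, of Newton's equations (gravitational constant `1`)
for finitely many bodies with common mass `m` in three-dimensional space. -/
structure IsNewtonSolution {ι : Type*} [Fintype ι] [DecidableEq ι] (m : ℝ)
    (q : ι → ℝ → EuclideanSpace ℝ (Fin 3)) : Prop where
  no_collision : ∀ i j, i ≠ j → ∀ t, q i t ≠ q j t
  differentiable : ∀ i, Differentiable ℝ (q i)
  newton : ∀ i t, HasDerivAt (deriv (q i))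
    (∑ j ∈ Finset.univ.erase i, (m / ‖q j t - q i t‖ ^ 3) • (q j t - q i t)) t

end

/-!
The equations of motion are reversible in two ways, and this reduces the construction of periodic
orbits to a shooting problem on a quarter period. If a solution satisfies `r' = 0` and `d' = 0` at
some time `T`, then reflecting time about `0` and about `T` maps it to itself (`eq_of_reversible`),
so it is `4T`-periodic and doubly symmetric. It therefore suffices to solve `r'(T) = 0`,
`d'(T) = 0` for `(a, T)` as a continuous function of `b`.

At `b = 0` the second equation is void, so one writes `d = b δ` and asks for `δ'(T) = 0` instead.
For `b = 0` the rescaled system has the explicit solution `r = r₀`, `δ = sin (ω t) / ω`, with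
`ω² = m α_N / r₀³`, and its quarter period is `T₀ = π / (2ω)`. The variation of `r` with respect
to `a` oscillates with the frequency `κ`, where `κ² = m γ_N / r₀³`; hence the Jacobian of the
shooting map in `(a, T)` is triangular with diagonal entries `(2 / r₀) sin (κ T₀)` and `-ω`. It
is invertible as soon as `κ < 2ω`, that is, `γ_N < 4 α_N`, which holds because every summand
`1 / sin (kπ/2N)` of even index is bounded by the sum of its two neighbours of odd index, so that
`∑ 1 / sin ≤ 3 ∑ 1 / sin < 4 ∑ 1 / sin³` with the last two sums over odd indices
(`hipHopGamma_lt`). The implicit function theorem then gives the branch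
(`exists_symmetric_branch`).

The shooting map is shown to be strictly differentiable (`hasStrictFDerivAt_endpoint`) by applying
Grönwall's inequality to the difference between two solutions minus a solution of the linearized
equation. To have all solutions on all of `ℝ`, the vector field is first clipped to a box around the
circular orbit; the solutions on the branch turn out to remain in the box for all times.

Newton's equations (`IsHipHopMotion.isNewtonSolution`) are a direct computation: seen from one
body, the tangential forces of the others cancel in pairs, the radial ones add up to `-2 r m f` and
the vertical ones to `-(m d / 2) g`.
-/

section

open Set Filter Topology NNReal

/-! ### Bounded Lipschitz vector fields and dependence on parameters -/

section

variable {E F P S : Type*} [NormedAddCommGroup E] [NormedSpace ℝ E]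
  [NormedAddCommGroup F] [NormedSpace ℝ F] [NormedAddCommGroup P] [NormedSpace ℝ P]
  [NormedAddCommGroup S] [NormedSpace ℝ S]

/-- A bounded Lipschitz vector field has a solution defined for all times: Picard-Lindelöf applies
on every interval `[-n - 1, n + 1]` with a ball as large as needed, and by uniqueness the resulting
solutions agree where they overlap. -/
theorem exists_global_solution_of_lipschitz [CompleteSpace E] {V : E → E} {K : ℝ≥0} {L : ℝ}
    (hV : LipschitzWith K V) (hL : ∀ x, ‖V x‖ ≤ L) (x₀ : E) :
    ∃ x : ℝ → E, x 0 = x₀ ∧ ∀ t, HasDerivAt x (V (x t)) t := by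
  have hL0 : 0 ≤ L := (norm_nonneg _).trans (hL 0)
  have hloc : ∀ n : ℕ, ∃ x : ℝ → E, x 0 = x₀ ∧
      ∀ t ∈ Ioo (-(n + 1 : ℝ)) (n + 1), HasDerivAt x (V (x t)) t := by
    intro n
    have hn : (0 : ℝ) < n + 1 := by positivity
    have hmem : (0 : ℝ) ∈ Icc (-(n + 1 : ℝ)) (n + 1) := ⟨by linarith, by linarith⟩
    have hPL : IsPicardLindelof (fun _ ↦ V) (⟨0, hmem⟩ : Icc (-(n + 1 : ℝ)) (n + 1)) x₀
        (⟨L, hL0⟩ * ⟨n + 1, hn.le⟩) 0 ⟨L, hL0⟩ K := by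
      refine .of_time_independent (fun x _ ↦ hL x) hV.lipschitzOnWith ?_
      simp
      exact le_rfl
    obtain ⟨x, hx0, hx⟩ := hPL.exists_eq_forall_mem_Icc_hasDerivWithinAt₀
    exact ⟨x, hx0, fun t ht ↦
      (hx t (Ioo_subset_Icc_self ht)).hasDerivAt (Icc_mem_nhds ht.1 ht.2)⟩
  choose y hy0 hy using hloc
  have hagree : ∀ n k : ℕ, n ≤ k → EqOn (y n) (y k) (Ioo (-(n + 1 : ℝ)) (n + 1)) := by
    intro n k hnk
    have hk : (n : ℝ) ≤ k := by exact_mod_cast hnk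
    refine ODE_solution_unique_of_mem_Ioo (v := fun _ ↦ V) (s := fun _ ↦ univ) (t₀ := 0)
      (fun t _ ↦ hV.lipschitzOnWith) ⟨by linarith [n.cast_nonneg (α := ℝ)], by positivity⟩
      (fun t ht ↦ ⟨hy n t ht, trivial⟩)
      (fun t ht ↦ ⟨hy k t ⟨by linarith [ht.1], by linarith [ht.2]⟩, trivial⟩) ?_
    rw [hy0, hy0]
  refine ⟨fun t ↦ y ⌈|t|⌉₊ t, by simp [hy0], fun t ↦ ?_⟩
  set k := ⌈|t|⌉₊ + 1 with hk
  have habs : |t| ≤ ⌈|t|⌉₊ := Nat.le_ceil _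
  have hnear : ∀ᶠ s in 𝓝 t, |s| < |t| + 1 :=
    (continuous_abs.tendsto t).eventually (gt_mem_nhds (by linarith))
  have heq : (fun s ↦ y ⌈|s|⌉₊ s) =ᶠ[𝓝 t] y k := by
    filter_upwards [hnear] with s hs
    have h1 : ⌈|s|⌉₊ ≤ k := by
      rw [Nat.ceil_le, hk]; push_cast; linarith
    refine hagree _ _ h1 ?_
    have := Nat.le_ceil |s|
    constructor
    · linarith [neg_abs_le s]
    · linarith [le_abs_self s]
  have hd : HasDerivAt (y k) (V (y k t)) t := by
    apply hy
    rw [hk]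
    push_cast
    constructor
    · linarith [neg_abs_le t]
    · linarith [le_abs_self t]
  have := hd.congr_of_eventuallyEq heq
  rwa [← heq.eq_of_nhds] at this

/-- Grönwall's inequality for zero initial value, in a form that is linear in the inhomogeneity
`ε` and uniform on `[0, 1]`. -/
theorem norm_le_of_norm_deriv_le_on_unit_interval {u u' : ℝ → E} {K ε : ℝ} (hK : 0 ≤ K)
    (hε : 0 ≤ ε) (hu : ∀ t, HasDerivAt u (u' t) t) (h0 : u 0 = 0)
    (hbound : ∀ t ∈ Icc (0 : ℝ) 1, ‖u' t‖ ≤ K * ‖u t‖ + ε) :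
    ∀ t ∈ Icc (0 : ℝ) 1, ‖u t‖ ≤ gronwallBound 0 K 1 1 * ε := by
  intro t ht
  have h1 := norm_le_gronwallBound_of_norm_deriv_right_le (δ := 0) (a := 0) (b := 1)
    (fun s _ ↦ (hu s).continuousAt.continuousWithinAt) (fun s _ ↦ (hu s).hasDerivWithinAt)
    (by simp [h0]) (fun s hs ↦ hbound s (Ico_subset_Icc_self hs)) t ht
  have h2 : gronwallBound 0 K ε (t - 0) ≤ gronwallBound 0 K ε 1 :=
    gronwallBound_mono le_rfl hε hK (by linarith [ht.2])
  have h3 : gronwallBound 0 K ε 1 = gronwallBound 0 K 1 1 * ε := by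
    rcases eq_or_ne K 0 with rfl | hK0
    · simp [gronwallBound_K0]
    · simp [gronwallBound_of_K_ne_0 hK0]; ring
  linarith

theorem gronwallBound_zero_nonneg {K : ℝ} (hK : 0 ≤ K) : 0 ≤ gronwallBound 0 K 1 1 := by
  have := gronwallBound_mono le_rfl zero_le_one hK (zero_le_one' ℝ)
  rwa [gronwallBound_x0] at this

omit [NormedSpace ℝ P] in
/-- Solutions with the same initial value depend on the parameter in a Lipschitz way. -/
theorem norm_solution_sub_le {V : P × S → S} {K : ℝ≥0} (hV : LipschitzWith K V)
    {x y : ℝ → S} {μ ν : P} (hx : ∀ t, HasDerivAt x (V (μ, x t)) t)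
    (hy : ∀ t, HasDerivAt y (V (ν, y t)) t) (h0 : x 0 = y 0) :
    ∀ t ∈ Icc (0 : ℝ) 1, ‖x t - y t‖ ≤ gronwallBound 0 K 1 1 * (K * ‖μ - ν‖) := by
  refine norm_le_of_norm_deriv_le_on_unit_interval K.2 (by positivity)
    (fun t ↦ (hx t).sub (hy t)) (by simp [h0]) fun t _ ↦ ?_
  refine (hV.norm_sub_le _ _).trans ?_
  rw [Prod.mk_sub_mk, Prod.norm_mk, ← mul_add]
  gcongr
  exact max_le (by linarith [norm_nonneg (x t - y t)]) (by simp)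

/-- Strict differentiability of a `C¹` map along a curve is uniform on a compact time interval. -/
theorem eventually_forall_norm_sub_fderiv_le {V : E → F} {c : ℝ → E} (hc : Continuous c)
    (hV : ∀ t ∈ Icc (0 : ℝ) 1, ContDiffAt ℝ 1 V (c t)) {ε : ℝ} (hε : 0 < ε) :
    ∀ᶠ z : E × E in 𝓝 0, ∀ t ∈ Icc (0 : ℝ) 1,
      ‖V (c t + z.1) - V (c t + z.2) - fderiv ℝ V (c t) (z.1 - z.2)‖ ≤ ε * ‖z.1 - z.2‖ := by
  refine isCompact_Icc.eventually_forall_of_forall_eventually fun t₀ ht₀ ↦ ?_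
  have h1 := ((hV t₀ ht₀).hasStrictFDerivAt one_ne_zero).isLittleO.def (half_pos hε)
  have hcont : ContinuousAt (fderiv ℝ V) (c t₀) :=
    ((hV t₀ ht₀).fderiv_right (m := 0) (by norm_num)).continuousAt
  have h2 := Metric.tendsto_nhds.1 (hcont.comp hc.continuousAt) _ (half_pos hε)
  have ht : Tendsto (fun w : (E × E) × ℝ ↦ (c w.2 + w.1.1, c w.2 + w.1.2)) (𝓝 (0, t₀))
      (𝓝 (c t₀, c t₀)) := by
    have : Continuous (fun w : (E × E) × ℝ ↦ (c w.2 + w.1.1, c w.2 + w.1.2)) := by fun_prop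
    simpa using this.tendsto ((0 : E × E), t₀)
  have hs : Tendsto (fun w : (E × E) × ℝ ↦ w.2) (𝓝 (0, t₀)) (𝓝 t₀) :=
    continuous_snd.tendsto ((0 : E × E), t₀)
  filter_upwards [ht.eventually h1, hs.eventually h2] with w hw1 hw2
  simp only [add_sub_add_left_eq_sub] at hw1
  rw [dist_eq_norm] at hw2
  have e : V (c w.2 + w.1.1) - V (c w.2 + w.1.2) - fderiv ℝ V (c w.2) (w.1.1 - w.1.2)
      = (V (c w.2 + w.1.1) - V (c w.2 + w.1.2) - fderiv ℝ V (c t₀) (w.1.1 - w.1.2))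
        - (fderiv ℝ V (c w.2) - fderiv ℝ V (c t₀)) (w.1.1 - w.1.2) := by
    simp
  rw [e]
  refine (norm_sub_le _ _).trans ?_
  have h3 : ‖(fderiv ℝ V (c w.2) - fderiv ℝ V (c t₀)) (w.1.1 - w.1.2)‖
      ≤ ε / 2 * ‖w.1.1 - w.1.2‖ :=
    (ContinuousLinearMap.le_opNorm _ _).trans (by gcongr; exact hw2.le)
  linarith

/-- Differentiable dependence on parameters. The family `x μ` solves `x' = V (μ, x)` with an initial
value independent of `μ`. Then `μ ↦ x μ 1` is strictly differentiable at `μ₀`, and its derivative in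
the direction `h` is the value at time `1` of the solution `u h` of the linearized equation along
`x μ₀`. The map `L` that packages these values is an argument, so that only explicit solutions of
the linearized equation are ever needed. -/
theorem hasStrictFDerivAt_endpoint {V : P × S → S} {K : ℝ≥0} (hV : LipschitzWith K V)
    {x : P → ℝ → S} {x₀ : S} (h0 : ∀ μ, x μ 0 = x₀)
    (hx : ∀ μ t, HasDerivAt (x μ) (V (μ, x μ t)) t) {μ₀ : P}
    (hC : ∀ t ∈ Icc (0 : ℝ) 1, ContDiffAt ℝ 1 V (μ₀, x μ₀ t))
    {u : P → ℝ → S} (hu0 : ∀ h, u h 0 = 0)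
    (hu : ∀ h t, HasDerivAt (u h) (fderiv ℝ V (μ₀, x μ₀ t) (h, u h t)) t)
    {L : P →L[ℝ] S} (hL : ∀ h, L h = u h 1) :
    HasStrictFDerivAt (fun μ ↦ x μ 1) L μ₀ := by
  set G := gronwallBound 0 K 1 1 with hG
  have hG0 : 0 ≤ G := gronwallBound_zero_nonneg K.2
  have hsol := fun μ ν ↦ norm_solution_sub_le hV (hx μ) (hx ν) (by rw [h0, h0])
  have hc : Continuous fun t ↦ (μ₀, x μ₀ t) :=
    continuous_const.prodMk (continuous_iff_continuousAt.2 fun t ↦ (hx μ₀ t).continuousAt)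
  refine .of_isLittleO (Asymptotics.isLittleO_iff.2 fun {c} hc0 ↦ ?_)
  obtain ⟨ε, hε, hεc⟩ : ∃ ε > 0, G * (ε * (1 + G * K)) ≤ c := by
    refine ⟨c / (1 + G * (1 + G * K)), by positivity, ?_⟩
    rw [show G * (c / (1 + G * (1 + G * K)) * (1 + G * K))
      = c * ((G * (1 + G * K)) / (1 + G * (1 + G * K))) by ring]
    refine mul_le_of_le_one_right hc0.le ((div_le_one (by positivity)).2 (by linarith))
  obtain ⟨δ, hδ, hball⟩ := Metric.eventually_nhds_iff.1
    (eventually_forall_norm_sub_fderiv_le hc hC hε)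
  have hpt : ∀ᶠ μ in 𝓝 μ₀, ∀ t ∈ Icc (0 : ℝ) 1, ‖(μ - μ₀, x μ t - x μ₀ t)‖ < δ := by
    have : Tendsto (fun μ ↦ (1 + G * K) * ‖μ - μ₀‖) (𝓝 μ₀) (𝓝 0) := by
      have : Continuous fun μ ↦ (1 + G * K) * ‖μ - μ₀‖ := by fun_prop
      simpa using this.tendsto μ₀
    filter_upwards [this.eventually (gt_mem_nhds hδ)] with μ hμ t ht
    refine lt_of_le_of_lt ?_ hμ
    rw [Prod.norm_mk]
    have h1 := hsol μ μ₀ t ht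
    have h2 : 0 ≤ G * K * ‖μ - μ₀‖ := by positivity
    exact max_le (by linarith) (by linarith [norm_nonneg (μ - μ₀)])
  rw [nhds_prod_eq]
  filter_upwards [hpt.prod_mk hpt] with ⟨μ, ν⟩ ⟨hμ, hν⟩
  set A := fun t ↦ fderiv ℝ V (μ₀, x μ₀ t)
  have hA : ∀ t, ‖A t‖ ≤ K := fun t ↦ norm_fderiv_le_of_lipschitz ℝ hV
  -- Grönwall applied to the defect `x μ - x ν - u (μ - ν)`
  have key := norm_le_of_norm_deriv_le_on_unit_interval (K := K) (ε := ε * (1 + G * K) * ‖μ - ν‖)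
    K.2 (by positivity) (fun t ↦ ((hx μ t).sub (hx ν t)).sub (hu (μ - ν) t))
    (by simp [h0, hu0]) (fun t ht ↦ ?_) 1 (by simp)
  · simp only [Pi.sub_apply] at key
    rw [hL]
    refine key.trans ?_
    calc G * (ε * (1 + G * K) * ‖μ - ν‖) = G * (ε * (1 + G * K)) * ‖μ - ν‖ := by ring
      _ ≤ c * ‖μ - ν‖ := by gcongr
  · simp only [Pi.sub_apply]
    have hb := hball (y := ((μ - μ₀, x μ t - x μ₀ t), (ν - μ₀, x ν t - x μ₀ t)))
      (by rw [dist_zero_right, Prod.norm_mk]; exact max_lt (hμ t ht) (hν t ht)) t ht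
    simp only [Prod.mk_add_mk, add_sub_cancel, Prod.mk_sub_mk, sub_sub_sub_cancel_right] at hb
    have e : V (μ, x μ t) - V (ν, x ν t) - A t (μ - ν, u (μ - ν) t)
        = (V (μ, x μ t) - V (ν, x ν t) - A t (μ - ν, x μ t - x ν t))
          + A t (0, x μ t - x ν t - u (μ - ν) t) := by
      rw [sub_add, ← map_sub, Prod.mk_sub_mk, sub_zero, sub_sub_cancel]
    refine (congrArg norm e).trans_le ((norm_add_le _ _).trans ?_)
    have h1 : ‖A t (0, x μ t - x ν t - u (μ - ν) t)‖ ≤ K * ‖x μ t - x ν t - u (μ - ν) t‖ := by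
      refine (ContinuousLinearMap.le_of_opNorm_le _ (hA t) _).trans_eq ?_
      simp [Prod.norm_mk]
    have h2 : ‖(μ - ν, x μ t - x ν t)‖ ≤ (1 + G * K) * ‖μ - ν‖ := by
      rw [Prod.norm_mk]
      have h1 := hsol μ ν t ht
      have h2 : 0 ≤ G * K * ‖μ - ν‖ := by positivity
      exact max_le (by linarith) (by linarith [norm_nonneg (μ - ν)])
    have h3 : ε * ‖(μ - ν, x μ t - x ν t)‖ ≤ ε * (1 + G * K) * ‖μ - ν‖ := by
      rw [mul_assoc]; gcongr
    linarith

theorem exists_lipschitzOnWith_of_contDiffAt {V : E → F} {s : Set E} (hs : IsCompact s)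
    (hV : ∀ x ∈ s, ContDiffAt ℝ 1 V x) : ∃ K, LipschitzOnWith K V s := by
  refine LocallyLipschitzOn.exists_lipschitzOnWith_of_compact hs fun x hx ↦ ?_
  obtain ⟨K, t, ht, h⟩ := (hV x hx).exists_lipschitzOnWith
  exact ⟨K, t, mem_nhdsWithin_of_mem_nhds ht, h⟩

/-- Precomposing a `C¹` map with a Lipschitz retraction into a compact set makes it globally
Lipschitz and bounded. -/
theorem exists_lipschitzWith_comp_and_bounded {E' : Type*} [NormedAddCommGroup E']
    {V : E → F} {s : Set E} (hs : IsCompact s) (hV : ∀ x ∈ s, ContDiffAt ℝ 1 V x)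
    {c : E' → E} {L : ℝ≥0} (hc : LipschitzWith L c) (hcs : ∀ x, c x ∈ s) :
    ∃ (K : ℝ≥0) (B : ℝ), LipschitzWith K (V ∘ c) ∧ ∀ x, ‖V (c x)‖ ≤ B := by
  obtain ⟨K, hK⟩ := exists_lipschitzOnWith_of_contDiffAt hs hV
  obtain ⟨B, hB⟩ := hs.exists_bound_of_continuousOn
    fun x hx ↦ (hV x hx).continuousAt.continuousWithinAt
  refine ⟨K * L, B, ?_, fun x ↦ hB _ (hcs x)⟩
  rw [← lipschitzOnWith_univ]
  exact hK.comp hc.lipschitzOnWith fun x _ ↦ hcs x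

/-- Uniqueness for global solutions that stay where the vector field is `C¹`. -/
theorem eq_of_solutions_of_contDiffAt {V : E → E} {x y : ℝ → E}
    (hx : ∀ t, HasDerivAt x (V (x t)) t) (hy : ∀ t, HasDerivAt y (V (y t)) t)
    (hVx : ∀ t, ContDiffAt ℝ 1 V (x t)) (hVy : ∀ t, ContDiffAt ℝ 1 V (y t))
    (h0 : x 0 = y 0) : x = y := by
  have hcx : Continuous x := continuous_iff_continuousAt.2 fun t ↦ (hx t).continuousAt
  have hcy : Continuous y := continuous_iff_continuousAt.2 fun t ↦ (hy t).continuousAt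
  ext t
  set n : ℝ := |t| + 1
  have hn : 0 < n := by positivity
  obtain ⟨K, hK⟩ := exists_lipschitzOnWith_of_contDiffAt (V := V)
    (s := x '' Icc (-n) n ∪ y '' Icc (-n) n)
    ((isCompact_Icc.image hcx).union (isCompact_Icc.image hcy)) (by
      rintro _ (⟨s, -, rfl⟩ | ⟨s, -, rfl⟩)
      exacts [hVx s, hVy s])
  refine ODE_solution_unique_of_mem_Ioo (v := fun _ ↦ V) (a := -n) (b := n) (t₀ := 0)
    (s := fun _ ↦ x '' Icc (-n) n ∪ y '' Icc (-n) n) (fun t _ ↦ hK) ⟨by linarith, hn⟩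
    (fun s hs ↦ ⟨hx s, .inl ⟨s, Ioo_subset_Icc_self hs, rfl⟩⟩)
    (fun s hs ↦ ⟨hy s, .inr ⟨s, Ioo_subset_Icc_self hs, rfl⟩⟩) h0
    ⟨by linarith [neg_abs_le t], by linarith [le_abs_self t]⟩

end

/-! ### The sums `f`, `g` and the constants `α_N`, `γ_N` -/

theorem sin_pos_of_mem_Icc {N k : ℕ} (hk : k ∈ Finset.Icc 1 (2 * N - 1)) :
    0 < Real.sin (k * Real.pi / (2 * N)) := by
  rw [Finset.mem_Icc] at hk
  have hN : (0 : ℝ) < 2 * N := by norm_cast; omega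
  have h1 : (0 : ℝ) < k := by norm_cast; omega
  have h2 : (k : ℝ) < 2 * N := by norm_cast; omega
  apply Real.sin_pos_of_pos_of_lt_pi
  · positivity
  · rw [div_lt_iff₀ hN, mul_comm]
    gcongr

theorem radicand_pos {N k : ℕ} (hk : k ∈ Finset.Icc 1 (2 * N - 1)) {r : ℝ} (hr : 0 < r) (d : ℝ) :
    0 < 4 * r ^ 2 * Real.sin (k * Real.pi / (2 * N)) ^ 2 + ((-1 : ℝ) ^ k - 1) ^ 2 * d ^ 2 := by
  have := sin_pos_of_mem_Icc hk
  positivity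

theorem contDiffAt_hipHopF (N : ℕ) {x : ℝ × ℝ} (hx : 0 < x.1) :
    ContDiffAt ℝ 1 (fun x : ℝ × ℝ ↦ hipHopF N x.1 x.2) x := by
  unfold hipHopF
  refine ContDiffAt.sum fun k hk ↦ ?_
  have hp := radicand_pos hk hx x.2
  refine contDiffAt_const.div (ContDiffAt.rpow_const_of_ne (by fun_prop) hp.ne') ?_
  positivity

theorem contDiffAt_hipHopG (N : ℕ) {x : ℝ × ℝ} (hx : 0 < x.1) :
    ContDiffAt ℝ 1 (fun x : ℝ × ℝ ↦ hipHopG N x.1 x.2) x := by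
  unfold hipHopG
  refine ContDiffAt.sum fun k hk ↦ ?_
  have hp := radicand_pos hk hx x.2
  refine contDiffAt_const.div (ContDiffAt.rpow_const_of_ne (by fun_prop) hp.ne') ?_
  positivity

theorem hipHopF_neg (N : ℕ) (r d : ℝ) : hipHopF N r (-d) = hipHopF N r d := by
  simp [hipHopF]

theorem hipHopG_neg (N : ℕ) (r d : ℝ) : hipHopG N r (-d) = hipHopG N r d := by
  simp [hipHopG]

theorem sq_rpow_three_halves {x : ℝ} (hx : 0 ≤ x) : (x ^ 2) ^ (3 / 2 : ℝ) = x ^ 3 := by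
  rw [← Real.rpow_natCast x 2, ← Real.rpow_mul hx, ← Real.rpow_natCast x 3]
  norm_num

theorem hipHopF_zero (N : ℕ) {r : ℝ} (hr : 0 < r) :
    hipHopF N r 0 = hipHopGamma N / (2 * r ^ 3) := by
  rw [hipHopF, hipHopGamma, mul_div_assoc, Finset.sum_div, Finset.mul_sum]
  refine Finset.sum_congr rfl fun k hk ↦ ?_
  have hs := sin_pos_of_mem_Icc hk
  set s := Real.sin (k * Real.pi / (2 * N))
  rw [show 4 * r ^ 2 * s ^ 2 + ((-1 : ℝ) ^ k - 1) ^ 2 * 0 ^ 2 = (2 * r * s) ^ 2 by ring,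
    sq_rpow_three_halves (by positivity)]
  field_simp
  norm_num

theorem hipHopG_zero (N : ℕ) {r : ℝ} (hr : 0 < r) :
    hipHopG N r 0 = 2 * hipHopAlpha N / r ^ 3 := by
  rw [hipHopG, hipHopAlpha, ← mul_assoc, mul_div_assoc, Finset.sum_div, Finset.mul_sum]
  refine Finset.sum_congr rfl fun k hk ↦ ?_
  have hs := sin_pos_of_mem_Icc hk
  set s := Real.sin (k * Real.pi / (2 * N))
  rw [show 4 * r ^ 2 * s ^ 2 + ((-1 : ℝ) ^ k - 1) ^ 2 * 0 ^ 2 = (2 * r * s) ^ 2 by ring,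
    sq_rpow_three_halves (by positivity)]
  field_simp
  norm_num

theorem hipHopGamma_pos {N : ℕ} (hN : 1 < N) : 0 < hipHopGamma N := by
  refine mul_pos (by norm_num) (Finset.sum_pos (fun k hk ↦ ?_) ⟨1, by simp; omega⟩)
  have := sin_pos_of_mem_Icc hk
  positivity

theorem sum_Icc_eq_sum_odd_add_sum_even (f : ℕ → ℝ) (n : ℕ) :
    ∑ k ∈ Finset.Icc 1 (2 * (n + 1) - 1), f k
      = ∑ j ∈ Finset.range (n + 1), f (2 * j + 1) + ∑ j ∈ Finset.range n, f (2 * j + 2) := by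
  induction n with
  | zero => simp
  | succ n ih =>
    rw [show 2 * (n + 1 + 1) - 1 = (2 * (n + 1) - 1) + 1 + 1 by omega,
      Finset.sum_Icc_succ_top (by omega), Finset.sum_Icc_succ_top (by omega), ih,
      Finset.sum_range_succ (fun j ↦ f (2 * j + 1)) (n + 1),
      Finset.sum_range_succ (fun j ↦ f (2 * j + 2)) n]
    rw [show 2 * (n + 1) - 1 + 1 = 2 * n + 2 by omega,
      show 2 * n + 2 + 1 = 2 * (n + 1) + 1 by omega]
    ring

/-- The non-resonance condition: the radial frequency `√(m γ_N / r₀³)` of the circular orbit is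
less than twice the vertical frequency `√(m α_N / r₀³)`. -/
theorem hipHopGamma_lt {N : ℕ} (hN : 1 < N) : hipHopGamma N < 4 * hipHopAlpha N := by
  obtain ⟨n, rfl⟩ : ∃ n, N = n + 1 := ⟨N - 1, by omega⟩
  set s : ℕ → ℝ := fun k ↦ Real.sin (k * Real.pi / (2 * (n + 1 : ℕ))) with hs
  have hpos : ∀ k ∈ Finset.Icc 1 (2 * (n + 1) - 1), 0 < s k := fun k hk ↦ sin_pos_of_mem_Icc hk
  have hodd : ∀ j ∈ Finset.range (n + 1), 0 < s (2 * j + 1) := fun j hj ↦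
    hpos _ (by simp at hj ⊢; omega)
  have hγ : hipHopGamma (n + 1) = 1 / 4 * (∑ j ∈ Finset.range (n + 1), 1 / s (2 * j + 1)
      + ∑ j ∈ Finset.range n, 1 / s (2 * j + 2)) := by
    rw [hipHopGamma, ← sum_Icc_eq_sum_odd_add_sum_even (fun k ↦ 1 / s k)]
  have hα : hipHopAlpha (n + 1) = 1 / 4 * ∑ j ∈ Finset.range (n + 1), 1 / s (2 * j + 1) ^ 3 := by
    rw [hipHopAlpha, sum_Icc_eq_sum_odd_add_sum_even
      (fun k ↦ ((-1 : ℝ) ^ k - 1) ^ 2 / s k ^ 3)]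
    have h1 (j : ℕ) : (-1 : ℝ) ^ (2 * j + 1) = -1 := by simp [pow_succ, pow_mul]
    have h2 (j : ℕ) : (-1 : ℝ) ^ (2 * j + 2) = 1 := by simp [pow_succ, pow_mul]
    simp only [h1, h2, sub_self, Finset.mul_sum, mul_add]
    norm_num
    refine Finset.sum_congr rfl fun j _ ↦ ?_
    ring
  -- since `sin` is concave, one of the odd neighbours of an even index has a smaller sine
  have heven : ∑ j ∈ Finset.range n, 1 / s (2 * j + 2)
      ≤ 2 * ∑ j ∈ Finset.range (n + 1), 1 / s (2 * j + 1) := by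
    have h1 : ∀ j ∈ Finset.range n,
        1 / s (2 * j + 2) ≤ 1 / s (2 * j + 1) + 1 / s (2 * (j + 1) + 1) := by
      intro j hj
      rw [Finset.mem_range] at hj
      have p1 := hodd j (by simp; omega)
      have p3 := hodd (j + 1) (by simp; omega)
      have p2 := hpos (2 * j + 2) (by simp; omega)
      have hsum : s (2 * j + 1) + s (2 * (j + 1) + 1) ≤ 2 * s (2 * j + 2) := by
        have e1 : s (2 * j + 1) = Real.sin ((2 * j + 2 : ℕ) * Real.pi / (2 * (n + 1 : ℕ))
            - Real.pi / (2 * (n + 1 : ℕ))) := by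
          simp only [hs]; congr 1; push_cast; ring
        have e3 : s (2 * (j + 1) + 1) = Real.sin ((2 * j + 2 : ℕ) * Real.pi / (2 * (n + 1 : ℕ))
            + Real.pi / (2 * (n + 1 : ℕ))) := by
          simp only [hs]; congr 1; push_cast; ring
        rw [e1, e3, Real.sin_sub, Real.sin_add]
        have := mul_le_of_le_one_right p2.le (Real.cos_le_one (Real.pi / (2 * (n + 1 : ℕ))))
        simp only [hs] at this ⊢
        linarith
      rcases le_total (s (2 * j + 1)) (s (2 * j + 2)) with h | h
      · have := one_div_le_one_div_of_le p1 h
        have : 0 < 1 / s (2 * (j + 1) + 1) := by positivity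
        linarith
      · have := one_div_le_one_div_of_le p3 (show _ ≤ s (2 * j + 2) by linarith)
        have : 0 < 1 / s (2 * j + 1) := by positivity
        linarith
    have h2 := Finset.sum_le_sum h1
    rw [Finset.sum_add_distrib] at h2
    have h3 := Finset.sum_range_succ (fun j ↦ 1 / s (2 * j + 1)) n
    have h4 := Finset.sum_range_succ' (fun j ↦ 1 / s (2 * j + 1)) n
    have h5 := hodd n (by simp)
    have h6 := hodd 0 (by simp)
    have h7 : 0 < 1 / s (2 * n + 1) := by positivity
    have h8 : 0 < 1 / s (2 * 0 + 1) := by positivity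
    linarith
  have hcube : ∑ j ∈ Finset.range (n + 1), 1 / s (2 * j + 1)
      ≤ ∑ j ∈ Finset.range (n + 1), 1 / s (2 * j + 1) ^ 3 := by
    refine Finset.sum_le_sum fun j hj ↦ ?_
    have := hodd j hj
    exact one_div_le_one_div_of_le (by positivity)
      (pow_le_of_le_one this.le (Real.sin_le_one _) (by norm_num))
  have hpos' : 0 < ∑ j ∈ Finset.range (n + 1), 1 / s (2 * j + 1) :=
    Finset.sum_pos (fun j hj ↦ by have := hodd j hj; positivity) ⟨0, by simp⟩
  rw [hγ, hα]
  linarith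

theorem hipHopAlpha_pos {N : ℕ} (hN : 1 < N) : 0 < hipHopAlpha N := by
  linarith [hipHopGamma_pos hN, hipHopGamma_lt hN]

/-! ### The rescaled vector field -/

/-- The vector field of the rescaled problem. The parameters are `(b, a, T)` and the state is
`(r, p, δ, q)`: time is measured in units of `T`, `p` and `q` are the velocities of `r` and `δ` in
the original time, and the height is `d = b δ`. Dividing `d` by `b` turns the condition
`d' = 0`, which is void at `b = 0`, into the non-degenerate condition `q = 0`. -/
noncomputable def hipHopField (N : ℕ) (m : ℝ) (w : (ℝ × ℝ × ℝ) × (ℝ × ℝ × ℝ × ℝ)) :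
    ℝ × ℝ × ℝ × ℝ :=
  (w.1.2.2 * w.2.2.1,
   w.1.2.2 * (w.1.2.1 ^ 2 / w.2.1 ^ 3 - 2 * w.2.1 * m * hipHopF N w.2.1 (w.1.1 * w.2.2.2.1)),
   w.1.2.2 * w.2.2.2.2,
   w.1.2.2 * (-(m * w.2.2.2.1 / 2) * hipHopG N w.2.1 (w.1.1 * w.2.2.2.1)))

theorem contDiffAt_hipHopField (N : ℕ) (m : ℝ) {w : (ℝ × ℝ × ℝ) × (ℝ × ℝ × ℝ × ℝ)}
    (hw : 0 < w.2.1) : ContDiffAt ℝ 1 (hipHopField N m) w := by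
  have hF : ContDiffAt ℝ 1 (fun w : (ℝ × ℝ × ℝ) × (ℝ × ℝ × ℝ × ℝ) ↦
      hipHopF N w.2.1 (w.1.1 * w.2.2.2.1)) w :=
    (contDiffAt_hipHopF N (x := (w.2.1, w.1.1 * w.2.2.2.1)) hw).comp w
      (f := fun w : (ℝ × ℝ × ℝ) × (ℝ × ℝ × ℝ × ℝ) ↦ (w.2.1, w.1.1 * w.2.2.2.1)) (by fun_prop)
  have hG : ContDiffAt ℝ 1 (fun w : (ℝ × ℝ × ℝ) × (ℝ × ℝ × ℝ × ℝ) ↦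
      hipHopG N w.2.1 (w.1.1 * w.2.2.2.1)) w :=
    (contDiffAt_hipHopG N (x := (w.2.1, w.1.1 * w.2.2.2.1)) hw).comp w
      (f := fun w : (ℝ × ℝ × ℝ) × (ℝ × ℝ × ℝ × ℝ) ↦ (w.2.1, w.1.1 * w.2.2.2.1)) (by fun_prop)
  have hq : ContDiffAt ℝ 1 (fun w : (ℝ × ℝ × ℝ) × (ℝ × ℝ × ℝ × ℝ) ↦ w.1.2.1 ^ 2 / w.2.1 ^ 3) w :=
    ContDiffAt.div (by fun_prop) (by fun_prop) (by positivity)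
  unfold hipHopField
  fun_prop

/-- The state reflection `(r, p, δ, q) ↦ (r, -p, -δ, q)`, which fixes the initial states. -/
def reflectStart : (ℝ × ℝ × ℝ × ℝ) →L[ℝ] (ℝ × ℝ × ℝ × ℝ) :=
  (ContinuousLinearMap.id ℝ ℝ).prodMap
    ((-ContinuousLinearMap.id ℝ ℝ).prodMap
      ((-ContinuousLinearMap.id ℝ ℝ).prodMap (ContinuousLinearMap.id ℝ ℝ)))

/-- The state reflection `(r, p, δ, q) ↦ (r, -p, δ, -q)`, which fixes the states with `p = q = 0`
reached after a quarter period. -/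
def reflectQuarter : (ℝ × ℝ × ℝ × ℝ) →L[ℝ] (ℝ × ℝ × ℝ × ℝ) :=
  (ContinuousLinearMap.id ℝ ℝ).prodMap
    ((-ContinuousLinearMap.id ℝ ℝ).prodMap
      ((ContinuousLinearMap.id ℝ ℝ).prodMap (-ContinuousLinearMap.id ℝ ℝ)))

@[simp]
theorem reflectStart_apply (x : ℝ × ℝ × ℝ × ℝ) :
    reflectStart x = (x.1, -x.2.1, -x.2.2.1, x.2.2.2) := by
  simp [reflectStart, Prod.map]

@[simp]
theorem reflectQuarter_apply (x : ℝ × ℝ × ℝ × ℝ) :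
    reflectQuarter x = (x.1, -x.2.1, x.2.2.1, -x.2.2.2) := by
  simp [reflectQuarter, Prod.map]

theorem hipHopField_reflectStart (N : ℕ) (m : ℝ) (μ : ℝ × ℝ × ℝ) (x : ℝ × ℝ × ℝ × ℝ) :
    hipHopField N m (μ, reflectStart x) = -reflectStart (hipHopField N m (μ, x)) := by
  simp [hipHopField, hipHopF_neg, hipHopG_neg]
  ring

theorem hipHopField_reflectQuarter (N : ℕ) (m : ℝ) (μ : ℝ × ℝ × ℝ) (x : ℝ × ℝ × ℝ × ℝ) :
    hipHopField N m (μ, reflectQuarter x) = -reflectQuarter (hipHopField N m (μ, x)) := by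
  simp [hipHopField]

/-- For a function even in its second variable, the second partial derivative vanishes on the axis,
so that the derivative there is determined by the restriction to the axis. -/
theorem hasFDerivAt_of_even_snd {H : ℝ × ℝ → ℝ} {r h' : ℝ} (hd : DifferentiableAt ℝ H (r, 0))
    (heven : ∀ r d, H (r, -d) = H (r, d)) (h : HasDerivAt (fun s ↦ H (s, 0)) h' r) :
    HasFDerivAt H (h' • ContinuousLinearMap.fst ℝ ℝ ℝ) (r, 0) := by
  have hL := hd.hasFDerivAt
  have h1 : fderiv ℝ H (r, 0) (1, 0) = h' :=
    (hL.comp_hasDerivAt r ((hasDerivAt_id r).prodMk (hasDerivAt_const r (0 : ℝ)))).unique h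
  have h2 : fderiv ℝ H (r, 0) (0, 1) = 0 := by
    have e1 := hL.comp_hasDerivAt_of_eq (0 : ℝ)
      ((hasDerivAt_const (0 : ℝ) r).prodMk (hasDerivAt_id (0 : ℝ))) rfl
    have e2 := hL.comp_hasDerivAt_of_eq (0 : ℝ)
      ((hasDerivAt_const (0 : ℝ) r).prodMk (hasDerivAt_neg (0 : ℝ))) (by simp)
    have e3 := e1.unique (e2.congr_of_eventuallyEq (.of_forall fun s ↦ (heven r s).symm))
    rw [show ((0 : ℝ), (-1 : ℝ)) = -(0, 1) by simp, map_neg] at e3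
    linarith
  convert hL using 1
  ext
  · simp [h1]
  · simp [h2]

/-- The linearization of `hipHopField` at the planar states `b = 0`, `r = r₀`, `p = 0`. It does not
involve the variation `β` of `b`, because `f` and `g` are even in `d`. -/
theorem fderiv_hipHopField {N : ℕ} {m r₀ : ℝ} (hr₀ : 0 < r₀) (a T δ q β α τ ρ π η χ : ℝ) :
    fderiv ℝ (hipHopField N m) ((0, a, T), (r₀, 0, δ, q)) ((β, α, τ), (ρ, π, η, χ)) =
      (T * π,
       T * (2 * a * α / r₀ ^ 3 - 3 * a ^ 2 / r₀ ^ 4 * ρ + 2 * m * hipHopGamma N / r₀ ^ 3 * ρ)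
        + τ * (a ^ 2 / r₀ ^ 3 - m * hipHopGamma N / r₀ ^ 2),
       T * χ + τ * q,
       T * (-(m * hipHopAlpha N / r₀ ^ 3) * η + 3 * m * hipHopAlpha N / r₀ ^ 4 * δ * ρ)
        - τ * (m * hipHopAlpha N / r₀ ^ 3 * δ)) := by
  have hr0 : r₀ ≠ 0 := hr₀.ne'
  have hFd : HasFDerivAt (fun x : ℝ × ℝ ↦ hipHopF N x.1 x.2)
      ((-(3 * hipHopGamma N / (2 * r₀ ^ 4))) • ContinuousLinearMap.fst ℝ ℝ ℝ) (r₀, 0) := by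
    refine hasFDerivAt_of_even_snd ((contDiffAt_hipHopF N hr₀).differentiableAt one_ne_zero)
      (fun r d ↦ hipHopF_neg N r d) ?_
    have : HasDerivAt (fun s : ℝ ↦ hipHopGamma N / (2 * s ^ 3))
        (-(3 * hipHopGamma N / (2 * r₀ ^ 4))) r₀ := by
      convert! (hasDerivAt_const r₀ (hipHopGamma N)).div (((hasDerivAt_pow 3 r₀).const_mul 2))
        (by positivity) using 1
      field_simp
      ring
    refine this.congr_of_eventuallyEq ?_
    filter_upwards [lt_mem_nhds hr₀] with s hs using hipHopF_zero N hs
  have hGd : HasFDerivAt (fun x : ℝ × ℝ ↦ hipHopG N x.1 x.2)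
      ((-(6 * hipHopAlpha N / r₀ ^ 4)) • ContinuousLinearMap.fst ℝ ℝ ℝ) (r₀, 0) := by
    refine hasFDerivAt_of_even_snd ((contDiffAt_hipHopG N hr₀).differentiableAt one_ne_zero)
      (fun r d ↦ hipHopG_neg N r d) ?_
    have : HasDerivAt (fun s : ℝ ↦ 2 * hipHopAlpha N / s ^ 3)
        (-(6 * hipHopAlpha N / r₀ ^ 4)) r₀ := by
      convert! (hasDerivAt_const r₀ (2 * hipHopAlpha N)).div ((hasDerivAt_pow 3 r₀))
        (by positivity) using 1
      field_simp
      ring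
    refine this.congr_of_eventuallyEq ?_
    filter_upwards [lt_mem_nhds hr₀] with s hs using hipHopG_zero N hs
  have haff : ∀ c e : ℝ, HasDerivAt (fun s : ℝ ↦ c + s * e) e 0 := fun c e ↦ by
    simpa using ((hasDerivAt_id (0 : ℝ)).mul_const e).const_add c
  have hb := haff 0 β
  have ha := haff a α
  have hT := haff T τ
  have hr := haff r₀ ρ
  have hp := haff 0 π
  have hδ := haff δ η
  have hq := haff q χ
  have hV := ((contDiffAt_hipHopField N m (w := ((0, a, T), (r₀, 0, δ, q))) hr₀).differentiableAt
    one_ne_zero).hasFDerivAt.comp_hasDerivAt_of_eq (0 : ℝ)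
    ((hb.prodMk (ha.prodMk hT)).prodMk (hr.prodMk (hp.prodMk (hδ.prodMk hq)))) (by simp)
  have hF := hFd.comp_hasDerivAt_of_eq (0 : ℝ) (hr.prodMk (hb.mul hδ)) (by simp)
  have hG := hGd.comp_hasDerivAt_of_eq (0 : ℝ) (hr.prodMk (hb.mul hδ)) (by simp)
  refine hV.unique ?_
  have h1 := hT.mul hp
  have h2 := hT.mul (((ha.pow 2).div (hr.pow 3) (by simp [hr0])).sub
    (((hr.const_mul 2).mul_const m).mul hF))
  have h3 := hT.mul hq
  have h4 := hT.mul ((((hδ.const_mul m).div_const 2).neg).mul hG)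
  have := h1.prodMk (h2.prodMk (h3.prodMk h4))
  convert! this using 1
  simp [hipHopF_zero N hr₀, hipHopG_zero N hr₀]
  refine ⟨?_, ?_, ?_⟩ <;> field_simp <;> ring

/-! ### Clipping, reversibility and forced oscillations -/

theorem lipschitzWith_clip_real (lo hi : ℝ) : LipschitzWith 1 fun x : ℝ ↦ lo ⊔ (x ⊓ hi) :=
  (LipschitzWith.id.min_const hi).const_max lo

/-- Clipping to an order interval of a product is Lipschitz if it is so in both factors; `Prod` has
no `HasSolidNorm` instance from which this would follow. -/
theorem lipschitzWith_clip_prod {α β : Type*} [PseudoEMetricSpace α] [PseudoEMetricSpace β]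
    [Lattice α] [Lattice β] {lo hi : α × β}
    (h₁ : LipschitzWith 1 fun x : α ↦ lo.1 ⊔ (x ⊓ hi.1))
    (h₂ : LipschitzWith 1 fun x : β ↦ lo.2 ⊔ (x ⊓ hi.2)) :
    LipschitzWith 1 fun x : α × β ↦ lo ⊔ (x ⊓ hi) := by
  have := (h₁.comp LipschitzWith.prod_fst).prodMk (h₂.comp LipschitzWith.prod_snd)
  rwa [max_self, one_mul] at this

theorem clip_eq_self {α : Type*} [Lattice α] {lo hi x : α} (hx : x ∈ Icc lo hi) :
    lo ⊔ (x ⊓ hi) = x := by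
  rw [inf_eq_left.2 hx.2, sup_eq_right.2 hx.1]

theorem clip_mem_Icc {α : Type*} [Lattice α] {lo hi : α} (h : lo ≤ hi) (x : α) :
    lo ⊔ (x ⊓ hi) ∈ Icc lo hi :=
  ⟨le_sup_left, sup_le h inf_le_right⟩

theorem clip_neg (c x : ℝ) (hc : 0 ≤ c) : (-c) ⊔ (-x ⊓ c) = -((-c) ⊔ (x ⊓ c)) := by
  simp only [max_def, min_def]
  split_ifs <;> linarith

/-- A solution of a reversible system that meets the fixed space of the reversing symmetry `σ` at
time `c` is mapped to itself by `σ` and the time reflection about `c`. -/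
theorem eq_of_reversible {E : Type*} [NormedAddCommGroup E] [NormedSpace ℝ E] {V : E → E}
    {K : ℝ≥0} (hV : LipschitzWith K V) {σ : E →L[ℝ] E}
    (hσ : ∀ x, V (σ x) = -σ (V x)) {x : ℝ → E} (hx : ∀ t, HasDerivAt x (V (x t)) t) {c : ℝ}
    (hc : σ (x c) = x c) (t : ℝ) : x (2 * c - t) = σ (x t) := by
  have hy : ∀ t, HasDerivAt (fun s ↦ σ (x (2 * c - s))) (V (σ (x (2 * c - t)))) t := by
    intro t
    rw [hσ]
    have h1 : HasDerivAt (fun s ↦ x (2 * c - s)) (-V (x (2 * c - t))) t := by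
      simpa [Function.comp_def] using
        (hx (2 * c - t)).scomp t ((hasDerivAt_id t).const_sub (2 * c))
    simpa [Function.comp_def] using σ.hasFDerivAt.comp_hasDerivAt t h1
  have := ODE_solution_unique_univ (v := fun _ ↦ V) (s := fun _ ↦ univ) (t₀ := c)
    (fun _ ↦ hV.lipschitzOnWith) (fun t ↦ ⟨hy t, trivial⟩) (fun t ↦ ⟨hx t, trivial⟩)
    (by rw [two_mul, add_sub_cancel_right, hc])
  have h2 := congrFun this (2 * c - t)
  simp only [sub_sub_cancel] at h2
  exact h2.symm

/-- The reflections of the line about `0` and about `1` carry `[0, 1]` over the whole line. -/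
theorem forall_of_forall_Icc_of_symm {p : ℝ → Prop} (h : ∀ t ∈ Icc (0 : ℝ) 1, p t)
    (h0 : ∀ t, p t → p (-t)) (h1 : ∀ t, p t → p (2 - t)) (t : ℝ) : p t := by
  have hbase : ∀ t ∈ Icc (-1 : ℝ) 1, p t := by
    intro t ht
    rcases le_total 0 t with h' | h'
    · exact h t ⟨h', ht.2⟩
    · simpa using h0 (-t) (h (-t) ⟨by linarith, by linarith [ht.1]⟩)
  have hadd : ∀ t, p t → p (t + 2) := fun t ht ↦ by
    have := h1 _ (h0 t ht)
    rwa [sub_neg_eq_add, add_comm] at this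
  have hsub : ∀ t, p t → p (t - 2) := fun t ht ↦ by
    have := h0 _ (h1 t ht)
    rwa [neg_sub] at this
  have hint : ∀ (n : ℤ) (t : ℝ), p t → p (t + 2 * n) := by
    intro n
    induction n with
    | zero => simp
    | succ n ih =>
      intro t ht
      have := hadd _ (ih t ht)
      convert this using 1
      push_cast; ring
    | pred n ih =>
      intro t ht
      have := hsub _ (ih t ht)
      convert this using 1
      push_cast; ring
  set n := ⌊(t + 1) / 2⌋
  have hn1 := Int.floor_le ((t + 1) / 2)
  have hn2 := Int.lt_floor_add_one ((t + 1) / 2)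
  have := hint n (t - 2 * n) (hbase _ ⟨by linarith, by linarith⟩)
  rwa [sub_add_cancel] at this

theorem exists_primitive {h : ℝ → ℝ} (hh : Continuous h) :
    ∃ C : ℝ → ℝ, C 0 = 0 ∧ ∀ t, HasDerivAt C (h t) t :=
  ⟨fun t ↦ ∫ s in (0 : ℝ)..t, h s, by simp, fun t ↦
    intervalIntegral.integral_hasDerivAt_right (hh.intervalIntegrable _ _)
      hh.aestronglyMeasurable.stronglyMeasurableAtFilter hh.continuousAt⟩

/-- Variation of constants for `η' = T₀ χ`, `χ' = T₀ (-ω² η + h)` with zero initial values. -/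
theorem exists_forced_oscillation {ω T₀ : ℝ} (hω : 0 < ω) {h : ℝ → ℝ} (hh : Continuous h) :
    ∃ η χ : ℝ → ℝ, η 0 = 0 ∧ χ 0 = 0 ∧ (∀ t, HasDerivAt η (T₀ * χ t) t) ∧
      ∀ t, HasDerivAt χ (T₀ * (-ω ^ 2 * η t + h t)) t := by
  obtain ⟨C, hC0, hC⟩ := exists_primitive
    (h := fun t ↦ T₀ * Real.cos (ω * T₀ * t) * h t) (by fun_prop)
  obtain ⟨S, hS0, hS⟩ := exists_primitive
    (h := fun t ↦ T₀ * Real.sin (ω * T₀ * t) * h t) (by fun_prop)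
  have hlin : ∀ t, HasDerivAt (fun s ↦ ω * T₀ * s) (ω * T₀) t := fun t ↦ by
    simpa using (hasDerivAt_id t).const_mul (ω * T₀)
  refine ⟨fun t ↦ (Real.sin (ω * T₀ * t) * C t - Real.cos (ω * T₀ * t) * S t) / ω,
    fun t ↦ Real.cos (ω * T₀ * t) * C t + Real.sin (ω * T₀ * t) * S t,
    by simp [hC0, hS0], by simp [hC0, hS0], fun t ↦ ?_, fun t ↦ ?_⟩
  · convert! (((hlin t).sin.mul (hC t)).sub ((hlin t).cos.mul (hS t))).div_const ω using 1
    field_simp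
    ring
  · convert! ((hlin t).cos.mul (hC t)).add ((hlin t).sin.mul (hS t)) using 1
    have hω' : ∀ y, -ω ^ 2 * (y / ω) = -ω * y := fun y ↦ by field_simp
    rw [hω']
    linear_combination (-T₀ * h t) * (Real.sin_sq_add_cos_sq (ω * T₀ * t))

/-! ### The shooting map and its branch of zeros -/

/-- The rescaled solution at `b = 0`: the planar circular motion, together with the first-order
vertical oscillation `δ`. -/
noncomputable def circularOrbit (r₀ ω T₀ : ℝ) (t : ℝ) : ℝ × ℝ × ℝ × ℝ :=
  (r₀, 0, Real.sin (ω * T₀ * t) / ω, Real.cos (ω * T₀ * t))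

theorem hasDerivAt_circularOrbit {N : ℕ} {m r₀ ω κ T₀ : ℝ} (hr₀ : 0 < r₀) (hω : 0 < ω)
    (hωα : ω ^ 2 * r₀ ^ 3 = m * hipHopAlpha N) (hκγ : κ ^ 2 * r₀ ^ 3 = m * hipHopGamma N) (t : ℝ) :
    HasDerivAt (circularOrbit r₀ ω T₀)
      (hipHopField N m ((0, κ * r₀ ^ 2, T₀), circularOrbit r₀ ω T₀ t)) t := by
  have hlin : HasDerivAt (fun s ↦ ω * T₀ * s) (ω * T₀) t := by
    simpa using (hasDerivAt_id t).const_mul (ω * T₀)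
  have h := (hasDerivAt_const t r₀).prodMk ((hasDerivAt_const t (0 : ℝ)).prodMk
    ((hlin.sin.div_const ω).prodMk hlin.cos))
  refine h.congr_deriv ?_
  have hα : hipHopAlpha N * m = ω ^ 2 * r₀ ^ 3 := by linarith
  have hγ : hipHopGamma N * m = κ ^ 2 * r₀ ^ 3 := by linarith
  simp only [hipHopField, circularOrbit, zero_mul, mul_zero, hipHopF_zero N hr₀,
    hipHopG_zero N hr₀, Prod.mk.injEq, true_and]
  refine ⟨?_, ?_, ?_⟩
  · have : 2 * r₀ * m * (hipHopGamma N / (2 * r₀ ^ 3)) = κ ^ 2 * r₀ := by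
      field_simp
      linear_combination hγ
    rw [this]
    field_simp
    ring
  · field_simp
  · field_simp
    linear_combination Real.sin (ω * T₀ * t) * T₀ * hα

/-- The derivative of the shooting map `(b, a, T) ↦ (p(1), q(1))` at the circular orbit. With
`ω T₀ = π / 2` it is triangular in `(a, T)`, with diagonal entries `(2 / r₀) sin (κ T₀)` and `-ω`.
The vector field `V` only has to agree with `hipHopField` near the circular orbit. -/
theorem exists_strictFDerivAt_shooting {N : ℕ} {m r₀ ω κ T₀ : ℝ} (hr₀ : 0 < r₀) (hω : 0 < ω)
    (hκ : 0 < κ) (hωα : ω ^ 2 * r₀ ^ 3 = m * hipHopAlpha N)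
    (hκγ : κ ^ 2 * r₀ ^ 3 = m * hipHopGamma N) (hT : ω * T₀ = Real.pi / 2)
    {V : (ℝ × ℝ × ℝ) × (ℝ × ℝ × ℝ × ℝ) → ℝ × ℝ × ℝ × ℝ} {K : ℝ≥0} (hV : LipschitzWith K V)
    (hVeq : ∀ t, V =ᶠ[𝓝 ((0, κ * r₀ ^ 2, T₀), circularOrbit r₀ ω T₀ t)] hipHopField N m)
    {x : ℝ × ℝ × ℝ → ℝ → ℝ × ℝ × ℝ × ℝ} (hx0 : ∀ μ, x μ 0 = (r₀, 0, 0, 1))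
    (hx : ∀ μ t, HasDerivAt (x μ) (V (μ, x μ t)) t)
    (hbase : x (0, κ * r₀ ^ 2, T₀) = circularOrbit r₀ ω T₀) :
    ∃ (c : ℝ) (L : ℝ × ℝ × ℝ →L[ℝ] ℝ × ℝ),
      HasStrictFDerivAt (fun μ ↦ ((x μ 1).2.1, (x μ 1).2.2.2)) L (0, κ * r₀ ^ 2, T₀) ∧
      ∀ h, L h = (2 / r₀ * Real.sin (κ * T₀) * h.2.1, c * h.2.1 - ω * h.2.2) := by
  obtain ⟨η, χ, hη0, hχ0, hη, hχ⟩ := exists_forced_oscillation (T₀ := T₀) hω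
    (h := fun t ↦ 6 * ω / (r₀ ^ 2 * κ) * Real.sin (ω * T₀ * t) * (1 - Real.cos (κ * T₀ * t)))
    (by fun_prop)
  have hω0 := hω.ne'
  have hκ0 := hκ.ne'
  have hr0 := hr₀.ne'
  have hlin : ∀ c t : ℝ, HasDerivAt (fun s ↦ c * s) c t := fun c t ↦ by
    simpa using (hasDerivAt_id t).const_mul c
  -- the solutions of the linearized equation; the `T`-direction is the time derivative of the orbit
  set u : ℝ × ℝ × ℝ → ℝ → ℝ × ℝ × ℝ × ℝ := fun h t ↦
    (h.2.1 * (2 / (r₀ * κ) * (1 - Real.cos (κ * T₀ * t))),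
     h.2.1 * (2 / r₀ * Real.sin (κ * T₀ * t)),
     h.2.1 * η t + h.2.2 * (t * Real.cos (ω * T₀ * t)),
     h.2.1 * χ t + h.2.2 * (-ω * (t * Real.sin (ω * T₀ * t)))) with hu_def
  have hu : ∀ h t, HasDerivAt (u h)
      (fderiv ℝ V ((0, κ * r₀ ^ 2, T₀), x (0, κ * r₀ ^ 2, T₀) t) (h, u h t)) t := by
    rintro ⟨β, α, τ⟩ t
    rw [hbase, (hVeq t).fderiv_eq, circularOrbit, hu_def, fderiv_hipHopField hr₀]
    have h1 := (((hlin (κ * T₀) t).cos.const_sub 1).const_mul (2 / (r₀ * κ))).const_mul α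
    have h2 := ((hlin (κ * T₀) t).sin.const_mul (2 / r₀)).const_mul α
    have h3 := ((hη t).const_mul α).add
      (((hasDerivAt_id t).mul (hlin (ω * T₀) t).cos).const_mul τ)
    have h4 := ((hχ t).const_mul α).add
      ((((hasDerivAt_id t).mul (hlin (ω * T₀) t).sin).const_mul (-ω)).const_mul τ)
    refine (h1.prodMk (h2.prodMk (h3.prodMk h4))).congr_deriv ?_
    have hα : m * hipHopAlpha N / r₀ ^ 3 = ω ^ 2 := by rw [← hωα]; field_simp
    have hα' : 3 * m * hipHopAlpha N / r₀ ^ 4 = 3 * ω ^ 2 / r₀ := by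
      rw [mul_assoc, ← hωα]; field_simp
    have hγ : 2 * m * hipHopGamma N / r₀ ^ 3 = 2 * κ ^ 2 := by
      rw [mul_assoc, ← hκγ]; field_simp
    have hγ' : m * hipHopGamma N / r₀ ^ 2 = κ ^ 2 * r₀ := by rw [← hκγ]; field_simp
    rw [hα, hα', hγ, hγ']
    simp only [id_eq, Prod.mk.injEq]
    refine ⟨?_, ?_, ?_, ?_⟩ <;> field_simp <;> ring
  have hC : ∀ t ∈ Icc (0 : ℝ) 1,
      ContDiffAt ℝ 1 V ((0, κ * r₀ ^ 2, T₀), x (0, κ * r₀ ^ 2, T₀) t) := fun t _ ↦ by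
    rw [hbase]
    exact (contDiffAt_hipHopField N m hr₀).congr_of_eventuallyEq (hVeq t)
  have hL := hasStrictFDerivAt_endpoint hV hx0 hx hC (u := u)
    (fun h ↦ by simp [hu_def, hη0, hχ0]) hu
    (L := ((ContinuousLinearMap.fst ℝ ℝ ℝ).comp (.snd ℝ ℝ (ℝ × ℝ))).smulRight (u (0, 1, 0) 1)
      + ((ContinuousLinearMap.snd ℝ ℝ ℝ).comp (.snd ℝ ℝ (ℝ × ℝ))).smulRight (u (0, 0, 1) 1))
    (fun h ↦ by simp [hu_def])
  refine ⟨χ 1, _, (ContinuousLinearMap.prod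
    ((ContinuousLinearMap.fst ℝ ℝ (ℝ × ℝ)).comp (.snd ℝ ℝ (ℝ × ℝ × ℝ)))
    (((ContinuousLinearMap.snd ℝ ℝ ℝ).comp (.snd ℝ ℝ (ℝ × ℝ))).comp
      (.snd ℝ ℝ (ℝ × ℝ × ℝ)))).hasStrictFDerivAt.comp _ hL, fun h ↦ ?_⟩
  simp [hu_def, hT]
  refine ⟨?_, ?_⟩ <;> ring

/-- The branch of symmetric solutions of the rescaled system: the shooting equations
`p(1) = q(1) = 0` are solved for `(a, T)` as a function of `b`, and the reflections extend the
resulting arcs on `[0, 1]` to all times. The vector field is clipped to a box around the circular orbit in order to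
have a globally defined flow. -/
theorem exists_symmetric_branch {N : ℕ} {m r₀ ω κ T₀ : ℝ} (hr₀ : 0 < r₀) (hω : 0 < ω)
    (hκ : 0 < κ) (hωα : ω ^ 2 * r₀ ^ 3 = m * hipHopAlpha N)
    (hκγ : κ ^ 2 * r₀ ^ 3 = m * hipHopGamma N) (hT : ω * T₀ = Real.pi / 2)
    (hκω : κ < 2 * ω) :
    ∃ bhat > 0, ∃ a T : ℝ → ℝ, a 0 = κ * r₀ ^ 2 ∧ T 0 = T₀ ∧
      ContinuousOn a (Ioo (-bhat) bhat) ∧ ContinuousOn T (Ioo (-bhat) bhat) ∧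
      ∀ b ∈ Ioo (-bhat) bhat, 0 < T b ∧ ∃ x : ℝ → ℝ × ℝ × ℝ × ℝ,
        x 0 = (r₀, 0, 0, 1) ∧ (∀ t, 0 < (x t).1) ∧
        (∀ t, HasDerivAt x (hipHopField N m ((b, a b, T b), x t)) t) ∧
        (x 1).2.1 = 0 ∧ (x 1).2.2.2 = 0 ∧
        (∀ t, x (-t) = reflectStart (x t)) ∧ ∀ t, x (2 - t) = reflectQuarter (x t) := by
  have hT₀ : 0 < T₀ := by
    have : 0 < ω * T₀ := by rw [hT]; positivity
    exact (pos_iff_pos_of_mul_pos this).1 hω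
  set μ₀ : ℝ × ℝ × ℝ := (0, κ * r₀ ^ 2, T₀) with hμ₀
  set z := circularOrbit r₀ ω T₀ with hz
  set A : ℝ := κ * r₀ ^ 2 + 1 with hA
  set M : ℝ := 1 / ω + 1 with hM
  have hA0 : 0 < A := by positivity
  have hM0 : 0 < M := by positivity
  set lo : (ℝ × ℝ × ℝ) × (ℝ × ℝ × ℝ × ℝ) := ((-1, -A, T₀ / 2), (r₀ / 2, -1, -M, -2)) with hlo
  set hi : (ℝ × ℝ × ℝ) × (ℝ × ℝ × ℝ × ℝ) := ((1, A, 2 * T₀), (2 * r₀, 1, M, 2)) with hhi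
  have hlohi : lo ≤ hi := by
    simp only [hlo, hhi, Prod.mk_le_mk]
    refine ⟨⟨?_, ?_, ?_⟩, ?_, ?_, ?_, ?_⟩ <;> linarith
  set c : (ℝ × ℝ × ℝ) × (ℝ × ℝ × ℝ × ℝ) → (ℝ × ℝ × ℝ) × (ℝ × ℝ × ℝ × ℝ) :=
    fun w ↦ lo ⊔ (w ⊓ hi) with hc_def
  have hc : LipschitzWith 1 c := by
    refine lipschitzWith_clip_prod (lipschitzWith_clip_prod (lipschitzWith_clip_real _ _)
      (lipschitzWith_clip_prod (lipschitzWith_clip_real _ _) (lipschitzWith_clip_real _ _)))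
      (lipschitzWith_clip_prod (lipschitzWith_clip_real _ _)
      (lipschitzWith_clip_prod (lipschitzWith_clip_real _ _)
      (lipschitzWith_clip_prod (lipschitzWith_clip_real _ _) (lipschitzWith_clip_real _ _))))
  have hc_self : ∀ {w}, w ∈ Icc lo hi → c w = w := clip_eq_self
  obtain ⟨K, B, hV, hB⟩ := exists_lipschitzWith_comp_and_bounded (V := hipHopField N m)
    (isCompact_Icc (a := lo) (b := hi)) (fun w hw ↦ contDiffAt_hipHopField N m (by
      have : r₀ / 2 ≤ w.2.1 := hw.1.2.1
      linarith)) hc (clip_mem_Icc hlohi)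
  set V := hipHopField N m ∘ c with hV_def
  have hVμ : ∀ μ, LipschitzWith K fun y ↦ V (μ, y) := fun μ ↦ by
    have := hV.comp (LipschitzWith.prodMk_left μ)
    rwa [mul_one] at this
  choose x hx0 hx using fun μ ↦ exists_global_solution_of_lipschitz (hVμ μ)
    (fun y ↦ hB (μ, y)) (r₀, 0, 0, 1)
  -- the circular orbit stays in the interior of the box
  have hnhds : ∀ t, Icc lo hi ∈ 𝓝 (μ₀, z t) := by
    intro t
    have hs1 := Real.neg_one_le_sin (ω * T₀ * t)
    have hs2 := Real.sin_le_one (ω * T₀ * t)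
    have hs3 := div_le_div_of_nonneg_right hs1 hω.le
    have hs4 := div_le_div_of_nonneg_right hs2 hω.le
    have hc1 := Real.neg_one_le_cos (ω * T₀ * t)
    have hc2 := Real.cos_le_one (ω * T₀ * t)
    have hκr : 0 < κ * r₀ ^ 2 := by positivity
    rw [neg_div] at hs3
    simp only [hlo, hhi, Icc_prod_eq, hμ₀, hz, circularOrbit]
    refine prod_mem_nhds (prod_mem_nhds ?_ (prod_mem_nhds ?_ ?_))
      (prod_mem_nhds ?_ (prod_mem_nhds ?_ (prod_mem_nhds ?_ ?_))) <;>
    refine Icc_mem_nhds ?_ ?_ <;> linarith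
  have hVeq : ∀ t, V =ᶠ[𝓝 (μ₀, z t)] hipHopField N m := fun t ↦ by
    filter_upwards [hnhds t] with w hw
    rw [hV_def, Function.comp, hc_self hw]
  have hzd : ∀ t, HasDerivAt z (V (μ₀, z t)) t := fun t ↦ by
    rw [(hVeq t).eq_of_nhds]
    exact hasDerivAt_circularOrbit hr₀ hω hωα hκγ t
  have hbase : x μ₀ = z := ODE_solution_unique_univ (v := fun _ y ↦ V (μ₀, y))
    (s := fun _ ↦ univ) (t₀ := 0) (fun _ ↦ (hVμ μ₀).lipschitzOnWith)
    (fun t ↦ ⟨hx μ₀ t, trivial⟩) (fun t ↦ ⟨hzd t, trivial⟩)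
    (by simp [hx0, hz, circularOrbit])
  -- the shooting equations are solved by the implicit function theorem
  obtain ⟨e, L, hF, hL⟩ := exists_strictFDerivAt_shooting hr₀ hω hκ hωα hκγ hT hV hVeq hx0 hx hbase
  set F : ℝ × ℝ × ℝ → ℝ × ℝ := fun μ ↦ ((x μ 1).2.1, (x μ 1).2.2.2) with hF_def
  -- `0 < κ T₀ < 2 ω T₀ = π`
  have hsin : 2 / r₀ * Real.sin (κ * T₀) ≠ 0 := by
    have : 0 < Real.sin (κ * T₀) := by
      refine Real.sin_pos_of_pos_of_lt_pi (by positivity) ?_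
      calc κ * T₀ < 2 * ω * T₀ := by gcongr
        _ = Real.pi := by rw [mul_assoc, hT]; ring
    positivity
  have hinv : (L ∘L .inr ℝ ℝ (ℝ × ℝ)).IsInvertible := by
    set s := 2 / r₀ * Real.sin (κ * T₀)
    refine .of_inverse (g := (s⁻¹ • ContinuousLinearMap.fst ℝ ℝ ℝ).prod
      ((e * s⁻¹ / ω) • ContinuousLinearMap.fst ℝ ℝ ℝ - ω⁻¹ • ContinuousLinearMap.snd ℝ ℝ ℝ)) ?_ ?_
    · ext <;> simp [hL] <;> field_simp
      simp
    · ext <;> simp [hL] <;> field_simp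
      simp
  have hFμ₀ : F μ₀ = 0 := by
    simp [hF_def, hbase, hz, circularOrbit, hT]
  set ψ := hF.implicitFunctionOfProdDomain hinv with hψ
  have hψ0 : ψ 0 = (κ * r₀ ^ 2, T₀) :=
    (hF.eventually_apply_eq_iff_implicitFunctionOfProdDomain hinv).self_of_nhds.mp rfl
  have hψt : Tendsto (fun b ↦ (b, ψ b)) (𝓝 0) (𝓝 μ₀) := by
    rw [hμ₀, nhds_prod_eq]
    exact tendsto_id.prodMk (hF.tendsto_implicitFunctionOfProdDomain hinv)
  obtain ⟨Kψ, s, hs, hψL⟩ :=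
    (hF.hasStrictFDerivAt_implicitFunctionOfProdDomain hinv).exists_lipschitzOnWith
  have hbox : ∀ᶠ μ in 𝓝 μ₀, ∀ t ∈ Icc (0 : ℝ) 1, (μ, x μ t) ∈ Icc lo hi := by
    have hzc : Continuous z := continuous_iff_continuousAt.2 fun t ↦ (hzd t).continuousAt
    have h1 : ∀ᶠ v in 𝓝 (0 : (ℝ × ℝ × ℝ) × (ℝ × ℝ × ℝ × ℝ)), ∀ t ∈ Icc (0 : ℝ) 1,
        (μ₀, z t) + v ∈ Icc lo hi := by
      refine isCompact_Icc.eventually_forall_of_forall_eventually fun t _ ↦ ?_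
      have : Continuous fun w : ((ℝ × ℝ × ℝ) × (ℝ × ℝ × ℝ × ℝ)) × ℝ ↦ (μ₀, z w.2) + w.1 := by
        fun_prop
      exact (this.tendsto (0, t)).eventually (by rw [add_zero]; exact hnhds t)
    obtain ⟨δ, hδ, h2⟩ := Metric.eventually_nhds_iff.1 h1
    have h3 : ∀ᶠ μ in 𝓝 μ₀, gronwallBound 0 K 1 1 * (K * ‖μ - μ₀‖) < δ := by
      have : Continuous fun μ ↦ gronwallBound 0 K 1 1 * (K * ‖μ - μ₀‖) := by fun_prop
      exact (this.tendsto μ₀).eventually (gt_mem_nhds (by simpa using hδ))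
    filter_upwards [h3, Metric.ball_mem_nhds μ₀ hδ] with μ h4 h5 t ht
    have h6 := norm_solution_sub_le hV (hx μ) (hx μ₀) (by rw [hx0, hx0]) t ht
    have h7 := h2 (y := (μ - μ₀, x μ t - z t)) (by
      rw [dist_zero_right, Prod.norm_mk]
      refine max_lt (by rwa [mem_ball_iff_norm] at h5) ?_
      rw [← hbase]
      exact h6.trans_lt h4) t ht
    simpa using h7
  have hev := (hψt.eventually hbox).and ((hF.eventually_apply_implicitFunctionOfProdDomain hinv).and
    (eventually_mem_nhds_iff.2 hs))
  obtain ⟨bhat, hbhat, hev⟩ := Metric.eventually_nhds_iff_ball.1 hev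
  rw [Real.ball_eq_Ioo] at hev
  simp only [zero_sub, zero_add] at hev
  have hψc : ContinuousOn ψ (Ioo (-bhat) bhat) := fun b hb ↦
    (hψL.continuousOn.continuousAt (hev b hb).2.2).continuousWithinAt
  refine ⟨bhat, hbhat, fun b ↦ (ψ b).1, fun b ↦ (ψ b).2, congrArg Prod.fst hψ0,
    congrArg Prod.snd hψ0, hψc.fst, hψc.snd, fun b hb ↦ ?_⟩
  obtain ⟨hin, hFb, -⟩ := hev b hb
  set μ : ℝ × ℝ × ℝ := (b, ψ b) with hμ
  have hTb : T₀ / 2 ≤ (ψ b).2 := (hin 0 (by simp)).1.1.2.2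
  rw [show F _ = _ from hFμ₀] at hFb
  have hp1 : (x μ 1).2.1 = 0 := congrArg Prod.fst hFb
  have hq1 : (x μ 1).2.2.2 = 0 := congrArg Prod.snd hFb
  have hsymm0 : ∀ t, x μ (-t) = reflectStart (x μ t) := by
    intro t
    have := eq_of_reversible (hVμ μ) (σ := reflectStart) (c := 0) (fun y ↦ ?_) (hx μ)
      (by simp [hx0]) t
    · simpa using this
    · rw [hV_def, Function.comp, Function.comp, ← Prod.eta (c (μ, y)),
        ← hipHopField_reflectStart]
      congr 1
      simp only [hc_def, hlo, hhi, reflectStart_apply, Prod.inf_def, Prod.sup_def,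
        Prod.mk.injEq, true_and, and_true]
      exact ⟨clip_neg _ _ zero_le_one, clip_neg _ _ hM0.le⟩
  have hsymm1 : ∀ t, x μ (2 - t) = reflectQuarter (x μ t) := by
    intro t
    have := eq_of_reversible (hVμ μ) (σ := reflectQuarter) (c := 1) (fun y ↦ ?_) (hx μ)
      (by
        rw [reflectQuarter_apply]
        ext <;> simp [hp1, hq1]) t
    · simpa using this
    · rw [hV_def, Function.comp, Function.comp, ← Prod.eta (c (μ, y)),
        ← hipHopField_reflectQuarter]
      congr 1
      simp only [hc_def, hlo, hhi, reflectQuarter_apply, Prod.inf_def, Prod.sup_def,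
        Prod.mk.injEq, true_and]
      exact ⟨clip_neg _ _ zero_le_one, clip_neg _ _ zero_le_two⟩
  -- the box is invariant under both reflections, so the solution never feels the clipping
  have hall : ∀ t, (μ, x μ t) ∈ Icc lo hi := by
    refine forall_of_forall_Icc_of_symm hin (fun t ht ↦ ?_) (fun t ht ↦ ?_)
    · obtain ⟨⟨h1, h2⟩, h3, h4⟩ := ht
      obtain ⟨a1, a2, a3, a4⟩ := h2
      obtain ⟨b1, b2, b3, b4⟩ := h4
      rw [hsymm0, reflectStart_apply]
      simp only [hlo, hhi] at *
      refine ⟨⟨h1, a1, ?_, ?_, a4⟩, h3, b1, ?_, ?_, b4⟩ <;> simp only <;> linarith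
    · obtain ⟨⟨h1, h2⟩, h3, h4⟩ := ht
      obtain ⟨a1, a2, a3, a4⟩ := h2
      obtain ⟨b1, b2, b3, b4⟩ := h4
      rw [hsymm1, reflectQuarter_apply]
      simp only [hlo, hhi] at *
      refine ⟨⟨h1, a1, ?_, a3, ?_⟩, h3, b1, ?_, b3, ?_⟩ <;> simp only <;> linarith
  refine ⟨by linarith, x μ, hx0 μ, fun t ↦ ?_, fun t ↦ ?_, hp1, hq1, hsymm0, hsymm1⟩
  · have : r₀ / 2 ≤ (x μ t).1 := (hall t).1.2.1
    linarith
  · have := hx μ t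
    rwa [hV_def, Function.comp, hc_self (hall t)] at this

/-! ### Motions in the original time -/

/-- The equations for `(r, r', d, d')` are those of `hipHopField` with `b = T = 1`. -/
theorem IsHipHopMotion.hasDerivAt_phase {N : ℕ} {m r₀ a b : ℝ} {r d θ : ℝ → ℝ}
    (h : IsHipHopMotion N m r₀ a b r d θ) (t : ℝ) :
    HasDerivAt (fun s ↦ (r s, deriv r s, d s, deriv d s))
      (hipHopField N m ((1, a, 1), (r t, deriv r t, d t, deriv d t))) t := by
  refine ((h.differentiable_r t).hasDerivAt.prodMk ((h.ode_r t).prodMk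
    ((h.differentiable_d t).hasDerivAt.prodMk (h.ode_d t)))).congr_deriv ?_
  simp [hipHopField]

theorem IsHipHopMotion.unique {N : ℕ} {m r₀ a b : ℝ} {r d θ r' d' θ' : ℝ → ℝ}
    (h : IsHipHopMotion N m r₀ a b r d θ) (h' : IsHipHopMotion N m r₀ a b r' d' θ') :
    r' = r ∧ d' = d ∧ θ' = θ := by
  have hV : ∀ x : ℝ × ℝ × ℝ × ℝ, 0 < x.1 →
      ContDiffAt ℝ 1 (fun y ↦ hipHopField N m ((1, a, 1), y)) x := fun x hx ↦
    (contDiffAt_hipHopField N m (w := ((1, a, 1), x)) hx).comp x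
      (f := fun y ↦ (((1, a, 1) : ℝ × ℝ × ℝ), y)) (by fun_prop)
  have key := eq_of_solutions_of_contDiffAt (V := fun y ↦ hipHopField N m ((1, a, 1), y))
    h'.hasDerivAt_phase h.hasDerivAt_phase
    (fun t ↦ hV _ (h'.r_pos t)) (fun t ↦ hV _ (h.r_pos t))
    (by simp [h.r_zero, h'.r_zero, h.deriv_r_zero, h'.deriv_r_zero, h.d_zero, h'.d_zero,
      h.deriv_d_zero, h'.deriv_d_zero])
  have hr : r' = r := funext fun t ↦ congrArg Prod.fst (congrFun key t)
  have hd : d' = d := funext fun t ↦ congrArg (fun x ↦ x.2.2.1) (congrFun key t)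
  refine ⟨hr, hd, funext fun t ↦ ?_⟩
  have hθ : ∀ t, HasDerivAt (fun s ↦ θ' s - θ s) 0 t := fun t ↦ by
    have := (h'.ode_θ t).sub (h.ode_θ t)
    rw [hr, sub_self] at this
    exact this
  have := is_const_of_deriv_eq_zero (fun t ↦ (hθ t).differentiableAt) (fun t ↦ (hθ t).deriv) t 0
  rw [h.θ_zero, h'.θ_zero] at this
  linarith

theorem exists_angle {r : ℝ → ℝ} (hr : Continuous r) (hpos : ∀ t, 0 < r t) (a : ℝ) :
    ∃ θ : ℝ → ℝ, θ 0 = 0 ∧ ∀ t, HasDerivAt θ (a / r t ^ 2) t :=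
  exists_primitive (continuous_const.div (hr.pow 2) fun t ↦ (pow_pos (hpos t) 2).ne')

/-- Undoing the rescaling `t ↦ t / T`, `d = b δ`. The angle is obtained by a quadrature. -/
theorem exists_isHipHopMotion_of_rescaled {N : ℕ} {m r₀ a b T : ℝ} (hT : 0 < T)
    {x : ℝ → ℝ × ℝ × ℝ × ℝ} (hx0 : x 0 = (r₀, 0, 0, 1)) (hpos : ∀ t, 0 < (x t).1)
    (hx : ∀ t, HasDerivAt x (hipHopField N m ((b, a, T), x t)) t) :
    ∃ θ, IsHipHopMotion N m r₀ a b (fun t ↦ (x (t / T)).1) (fun t ↦ b * (x (t / T)).2.2.1) θ ∧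
      deriv (fun t ↦ (x (t / T)).1) = (fun t ↦ (x (t / T)).2.1) ∧
      deriv (fun t ↦ b * (x (t / T)).2.2.1) = (fun t ↦ b * (x (t / T)).2.2.2) := by
  have hy : ∀ t, HasDerivAt (fun s ↦ x (s / T))
      (T⁻¹ • hipHopField N m ((b, a, T), x (t / T))) t := fun t ↦ by
    have := (hx (t / T)).scomp t ((hasDerivAt_id t).div_const T)
    rwa [one_div] at this
  have h1 : ∀ t, HasDerivAt (fun s ↦ (x (s / T)).1) (x (t / T)).2.1 t := fun t ↦ by
    have := (hasFDerivAt_fst (𝕜 := ℝ) (p := x (t / T))).comp_hasDerivAt t (hy t)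
    refine this.congr_deriv ?_
    simp [hipHopField, hT.ne']
  have h2 : ∀ t, HasDerivAt (fun s ↦ (x (s / T)).2.1) (a ^ 2 / (x (t / T)).1 ^ 3
      - 2 * (x (t / T)).1 * m * hipHopF N (x (t / T)).1 (b * (x (t / T)).2.2.1)) t := fun t ↦ by
    have := (((ContinuousLinearMap.fst ℝ ℝ (ℝ × ℝ)).comp
      (.snd ℝ ℝ (ℝ × ℝ × ℝ))).hasFDerivAt (x := x (t / T))).comp_hasDerivAt t (hy t)
    refine this.congr_deriv ?_
    simp [hipHopField, hT.ne']
  have h3 : ∀ t, HasDerivAt (fun s ↦ b * (x (s / T)).2.2.1) (b * (x (t / T)).2.2.2) t := fun t ↦ by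
    have := (((((ContinuousLinearMap.fst ℝ ℝ ℝ).comp (.snd ℝ ℝ (ℝ × ℝ))).comp
      (.snd ℝ ℝ (ℝ × ℝ × ℝ))).hasFDerivAt (x := x (t / T))).comp_hasDerivAt t (hy t)).const_mul b
    refine this.congr_deriv ?_
    simp [hipHopField, hT.ne']
  have h4 : ∀ t, HasDerivAt (fun s ↦ b * (x (s / T)).2.2.2) (-(m * (b * (x (t / T)).2.2.1) / 2)
      * hipHopG N (x (t / T)).1 (b * (x (t / T)).2.2.1)) t := fun t ↦ by
    have := (((((ContinuousLinearMap.snd ℝ ℝ ℝ).comp (.snd ℝ ℝ (ℝ × ℝ))).comp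
      (.snd ℝ ℝ (ℝ × ℝ × ℝ))).hasFDerivAt (x := x (t / T))).comp_hasDerivAt t (hy t)).const_mul b
    refine this.congr_deriv ?_
    simp [hipHopField, hT.ne']
    ring
  have d1 : deriv (fun t ↦ (x (t / T)).1) = fun t ↦ (x (t / T)).2.1 := funext fun t ↦ (h1 t).deriv
  have d3 : deriv (fun t ↦ b * (x (t / T)).2.2.1) = fun t ↦ b * (x (t / T)).2.2.2 :=
    funext fun t ↦ (h3 t).deriv
  obtain ⟨θ, hθ0, hθ⟩ := exists_angle (r := fun t ↦ (x (t / T)).1)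
    (continuous_iff_continuousAt.2 fun t ↦ (h1 t).continuousAt) (fun t ↦ hpos _) a
  exact ⟨θ, {
    r_pos := fun t ↦ hpos _
    differentiable_r := fun t ↦ (h1 t).differentiableAt
    differentiable_d := fun t ↦ (h3 t).differentiableAt
    ode_r := fun t ↦ by rw [d1]; exact h2 t
    ode_d := fun t ↦ by rw [d3]; exact h4 t
    ode_θ := hθ
    r_zero := by simp [hx0]
    deriv_r_zero := by rw [d1]; simp [hx0]
    d_zero := by simp [hx0]
    deriv_d_zero := by rw [d3]; simp [hx0]
    θ_zero := hθ0 }, d1, d3⟩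

theorem exists_circular_isHipHopMotion {N : ℕ} {m r₀ a : ℝ} (hr₀ : 0 < r₀)
    (ha : a ^ 2 = m * hipHopGamma N * r₀) :
    ∃ θ, IsHipHopMotion N m r₀ a 0 (fun _ ↦ r₀) (fun _ ↦ 0) θ := by
  obtain ⟨θ, hθ0, hθ⟩ := exists_angle (r := fun _ ↦ r₀) continuous_const (fun _ ↦ hr₀) a
  refine ⟨θ, {
    r_pos := fun _ ↦ hr₀
    differentiable_r := differentiable_const _
    differentiable_d := differentiable_const _
    ode_r := fun t ↦ ?_
    ode_d := fun t ↦ ?_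
    ode_θ := hθ
    r_zero := rfl
    deriv_r_zero := by simp
    d_zero := rfl
    deriv_d_zero := by simp
    θ_zero := hθ0 }⟩
  · rw [deriv_const', hipHopF_zero N hr₀, ha]
    refine (hasDerivAt_const t (0 : ℝ)).congr_deriv ?_
    field_simp
    ring
  · rw [deriv_const']
    simpa using hasDerivAt_const t (0 : ℝ)

/-! ### Newton's equations for the antiprism -/

theorem Function.Periodic.sum_range_add {M : Type*} [AddCommGroup M] {h : ℕ → M} {n : ℕ}
    (hp : Function.Periodic h n) (i : ℕ) :
    ∑ k ∈ Finset.range n, h (i + k) = ∑ k ∈ Finset.range n, h k := by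
  induction i with
  | zero => simp
  | succ i ih =>
    rw [← ih]
    have h1 := Finset.sum_range_succ (fun k ↦ h (i + k)) n
    have h2 := Finset.sum_range_succ' (fun k ↦ h (i + k)) n
    rw [hp, h2, add_zero] at h1
    simpa only [add_right_comm, ← add_assoc] using add_right_cancel h1

theorem hasDerivAt_vec3 {x y z : ℝ → ℝ} {x' y' z' t : ℝ} (hx : HasDerivAt x x' t)
    (hy : HasDerivAt y y' t) (hz : HasDerivAt z z' t) :
    HasDerivAt (fun s ↦ !₂[x s, y s, z s]) !₂[x', y', z'] t := by
  have h : HasDerivAt (fun s ↦ ![x s, y s, z s]) ![x', y', z'] t := by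
    rw [hasDerivAt_pi]
    intro i
    fin_cases i
    exacts [hx, hy, hz]
  have := (PiLp.hasFDerivAt_toLp (𝕜 := ℝ) 2 ![x t, y t, z t]).comp_hasDerivAt t h
  exact this

theorem antiprismMatrix_pow (N j : ℕ) :
    antiprismMatrix N ^ j = !![Real.cos (j * (Real.pi / N)), -Real.sin (j * (Real.pi / N)), 0;
      Real.sin (j * (Real.pi / N)), Real.cos (j * (Real.pi / N)), 0; 0, 0, (-1) ^ j] := by
  induction j with
  | zero =>
    ext a b
    fin_cases a <;> fin_cases b <;> simp
  | succ j ih =>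
    rw [pow_succ, ih, antiprismMatrix]
    push_cast
    rw [add_mul, one_mul, Real.cos_add, Real.sin_add]
    ext a b
    fin_cases a <;> fin_cases b <;> simp [Matrix.mul_apply, Fin.sum_univ_three, pow_succ] <;> ring

/-- The position of the body with index `k` in the antiprism of radius `r`, phase `ψ` and height
`d`, as a `2N`-periodic function of a natural number `k`. -/
noncomputable def antiprismPosition (N : ℕ) (r ψ d : ℝ) (k : ℕ) : EuclideanSpace ℝ (Fin 3) :=
  !₂[r * Real.cos (ψ + k * (Real.pi / N)), r * Real.sin (ψ + k * (Real.pi / N)), (-1) ^ k * d]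

theorem antiprismBody_eq (N : ℕ) (r d θ : ℝ → ℝ) (j : Fin (2 * N)) (t : ℝ) :
    antiprismBody N r d θ j t = antiprismPosition N (r t) (θ t) (d t) j := by
  rw [antiprismBody, antiprismMatrix_pow, antiprismPosition, Real.cos_add, Real.sin_add]
  congr 1
  ext a
  fin_cases a <;> simp [Matrix.mulVec, dotProduct, Fin.sum_univ_three] <;> ring

theorem periodic_antiprismPosition {N : ℕ} (hN : 0 < N) (r ψ d : ℝ) :
    Function.Periodic (antiprismPosition N r ψ d) (2 * N) := by
  intro k
  have hN' : (N : ℝ) ≠ 0 := by positivity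
  have h : ψ + ((k + 2 * N : ℕ) : ℝ) * (Real.pi / N)
      = ψ + k * (Real.pi / N) + 2 * Real.pi := by
    push_cast
    field_simp
    ring
  rw [antiprismPosition, antiprismPosition, h, Real.cos_add_two_pi, Real.sin_add_two_pi, pow_add,
    pow_mul]
  simp

theorem norm_sq_antiprismPosition_sub (N : ℕ) (r ψ d : ℝ) (i k : ℕ) :
    ‖antiprismPosition N r ψ d (i + k) - antiprismPosition N r ψ d i‖ ^ 2
      = 4 * r ^ 2 * Real.sin (k * Real.pi / (2 * N)) ^ 2 + ((-1 : ℝ) ^ k - 1) ^ 2 * d ^ 2 := by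
  have h1 : ψ + ((i + k : ℕ) : ℝ) * (Real.pi / N) = (ψ + i * (Real.pi / N))
      + 2 * (k * Real.pi / (2 * N)) := by push_cast; ring
  have h2 : ((-1 : ℝ) ^ i) ^ 2 = 1 := by rw [← pow_mul, mul_comm, pow_mul]; simp
  rw [EuclideanSpace.norm_sq_eq, Fin.sum_univ_three]
  simp only [antiprismPosition, h1, pow_add, PiLp.sub_apply, Real.norm_eq_abs, sq_abs]
  set α := ψ + i * (Real.pi / N) with hα
  clear_value α
  simp only [Matrix.cons_val, Real.cos_add, Real.sin_add, Real.cos_two_mul, Real.sin_two_mul]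
  set s := Real.sin (k * Real.pi / (2 * N))
  set c := Real.cos (k * Real.pi / (2 * N))
  set S := Real.sin α
  set C := Real.cos α
  have hc : c ^ 2 = 1 - s ^ 2 := Real.cos_sq' _
  have hC : C ^ 2 = 1 - S ^ 2 := Real.cos_sq' _
  have e1 : (r * (C * (2 * c ^ 2 - 1) - S * (2 * s * c)) - r * C) ^ 2
      + (r * (S * (2 * c ^ 2 - 1) + C * (2 * s * c)) - r * S) ^ 2
      = r ^ 2 * (C ^ 2 + S ^ 2) * ((2 * c ^ 2 - 2) ^ 2 + 4 * s ^ 2 * c ^ 2) := by ring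
  have e2 : ((-1 : ℝ) ^ i * (-1) ^ k * d - (-1) ^ i * d) ^ 2
      = ((-1 : ℝ) ^ i) ^ 2 * (((-1 : ℝ) ^ k - 1) ^ 2 * d ^ 2) := by ring
  rw [e1, e2, h2, hc, hC]
  ring

theorem norm_cube_antiprismPosition_sub (N : ℕ) (r ψ d : ℝ) (i k : ℕ) :
    ‖antiprismPosition N r ψ d (i + k) - antiprismPosition N r ψ d i‖ ^ 3
      = (4 * r ^ 2 * Real.sin (k * Real.pi / (2 * N)) ^ 2
        + ((-1 : ℝ) ^ k - 1) ^ 2 * d ^ 2) ^ (3 / 2 : ℝ) := by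
  rw [← norm_sq_antiprismPosition_sub N r ψ d i k, sq_rpow_three_halves (norm_nonneg _)]

theorem antiprismPosition_ne {N : ℕ} {r : ℝ} (hr : 0 < r) (ψ d : ℝ) {i j : ℕ}
    (hij : i < j) (hj : j < 2 * N) :
    antiprismPosition N r ψ d i ≠ antiprismPosition N r ψ d j := by
  intro h
  obtain ⟨k, rfl⟩ := Nat.exists_eq_add_of_lt hij
  have h1 := norm_sq_antiprismPosition_sub N r ψ d i (k + 1)
  rw [← add_assoc, ← h, sub_self, norm_zero] at h1
  have := radicand_pos (N := N) (k := k + 1) (by simp; omega) hr d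
  rw [← h1] at this
  simp at this

/-- The tangential forces cancel: the bodies with indices `i + k` and `i + 2N - k` are mirror images
of each other with respect to the vertical plane through the axis and the body `i`. -/
theorem sum_sin_mul_eq_zero {N : ℕ} (r d : ℝ) :
    ∑ k ∈ Finset.Icc 1 (2 * N - 1), Real.sin (k * (Real.pi / N)) /
      (4 * r ^ 2 * Real.sin (k * Real.pi / (2 * N)) ^ 2
        + ((-1 : ℝ) ^ k - 1) ^ 2 * d ^ 2) ^ (3 / 2 : ℝ) = 0 := by
  set F : ℕ → ℝ := fun k ↦ Real.sin (k * (Real.pi / N)) /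
      (4 * r ^ 2 * Real.sin (k * Real.pi / (2 * N)) ^ 2
        + ((-1 : ℝ) ^ k - 1) ^ 2 * d ^ 2) ^ (3 / 2 : ℝ) with hF
  have h1 : ∑ k ∈ Finset.Icc 1 (2 * N - 1), F k = ∑ k ∈ Finset.Icc 1 (2 * N - 1), -F k := by
    refine Finset.sum_nbij' (fun k ↦ 2 * N - k) (fun k ↦ 2 * N - k) ?_ ?_ ?_ ?_ ?_
    · intro k hk; simp at hk ⊢; omega
    · intro k hk; simp at hk ⊢; omega
    · intro k hk; simp at hk; omega
    · intro k hk; simp at hk; omega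
    · intro k hk
      rw [Finset.mem_Icc] at hk
      have hN : (N : ℝ) ≠ 0 := by norm_cast; omega
      have hc : ((2 * N - k : ℕ) : ℝ) = 2 * N - k := by
        rw [Nat.cast_sub (by omega)]; push_cast; ring
      have hs1 : Real.sin ((2 * N - k : ℕ) * (Real.pi / N)) = -Real.sin (k * (Real.pi / N)) := by
        rw [hc, show (2 * N - k : ℝ) * (Real.pi / N) = 2 * Real.pi - k * (Real.pi / N) by
          field_simp, Real.sin_two_pi_sub]
      have hs2 : Real.sin ((2 * N - k : ℕ) * Real.pi / (2 * N))
          = Real.sin (k * Real.pi / (2 * N)) := by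
        rw [hc, show (2 * N - k : ℝ) * Real.pi / (2 * N) = Real.pi - k * Real.pi / (2 * N) by
          field_simp, Real.sin_pi_sub]
      have hs3 : (-1 : ℝ) ^ (2 * N - k) = (-1) ^ k := by
        have e1 : (-1 : ℝ) ^ (2 * N - k) * (-1) ^ k = 1 := by
          rw [← pow_add, Nat.sub_add_cancel (by omega), pow_mul]
          simp
        have e2 : ((-1 : ℝ) ^ k) ^ 2 = 1 := by rw [← pow_mul, mul_comm, pow_mul]; simp
        linear_combination (-1 : ℝ) ^ k * e1 - (-1 : ℝ) ^ (2 * N - k) * e2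
      simp only [hF, hs1, hs2, hs3, neg_div, neg_neg]
  rw [Finset.sum_neg_distrib] at h1
  linarith

/-- The total attraction on the body `i`. The term `k = i` of the sum is zero. -/
theorem sum_attraction_antiprismPosition {N : ℕ} (hN : 0 < N) (m r ψ d : ℝ) (i : ℕ) :
    ∑ k ∈ Finset.range (2 * N),
      (m / ‖antiprismPosition N r ψ d k - antiprismPosition N r ψ d i‖ ^ 3) •
        (antiprismPosition N r ψ d k - antiprismPosition N r ψ d i)
      = !₂[-(2 * r * m * hipHopF N r d) * Real.cos (ψ + i * (Real.pi / N)),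
          -(2 * r * m * hipHopF N r d) * Real.sin (ψ + i * (Real.pi / N)),
          (-1) ^ i * (-(m * d / 2) * hipHopG N r d)] := by
  have hp : Function.Periodic (fun k ↦
      (m / ‖antiprismPosition N r ψ d k - antiprismPosition N r ψ d i‖ ^ 3) •
        (antiprismPosition N r ψ d k - antiprismPosition N r ψ d i)) (2 * N) :=
    (periodic_antiprismPosition hN r ψ d).comp fun q ↦
      (m / ‖q - antiprismPosition N r ψ d i‖ ^ 3) • (q - antiprismPosition N r ψ d i)
  -- sum over the index difference; its value `0` contributes nothing
  rw [← hp.sum_range_add i, Finset.range_eq_Ico, Finset.sum_eq_sum_Ico_succ_bot (by omega)]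
  simp only [add_zero, sub_self, smul_zero, zero_add, norm_cube_antiprismPosition_sub]
  rw [show Finset.Ico 1 (2 * N) = Finset.Icc 1 (2 * N - 1) by ext; simp; omega]
  set w : ℕ → ℝ := fun k ↦ (4 * r ^ 2 * Real.sin (k * Real.pi / (2 * N)) ^ 2
        + ((-1 : ℝ) ^ k - 1) ^ 2 * d ^ 2) ^ (3 / 2 : ℝ) with hw
  set S := Real.sin (ψ + i * (Real.pi / N)) with hS
  set C := Real.cos (ψ + i * (Real.pi / N)) with hC
  have hsum0 : ∑ k ∈ Finset.Icc 1 (2 * N - 1), Real.sin (k * (Real.pi / N)) / w k = 0 :=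
    sum_sin_mul_eq_zero r d
  have hF : hipHopF N r d
    = ∑ k ∈ Finset.Icc 1 (2 * N - 1), Real.sin (k * Real.pi / (2 * N)) ^ 2 / w k := rfl
  have hG : hipHopG N r d
    = ∑ k ∈ Finset.Icc 1 (2 * N - 1), ((-1 : ℝ) ^ k - 1) ^ 2 / w k := rfl
  have hang : ∀ k : ℕ, ψ + ((i + k : ℕ) : ℝ) * (Real.pi / N)
      = (ψ + i * (Real.pi / N)) + k * (Real.pi / N) := fun k ↦ by push_cast; ring
  have hcos : ∀ k : ℕ, Real.cos (k * (Real.pi / N))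
      = 1 - 2 * Real.sin (k * Real.pi / (2 * N)) ^ 2 := fun k ↦ by
    rw [show (k : ℝ) * (Real.pi / N) = 2 * (k * Real.pi / (2 * N)) by ring, Real.cos_two_mul,
      Real.cos_sq']
    ring
  have hterm : ∀ k : ℕ, (m / w k) • (antiprismPosition N r ψ d (i + k)
      - antiprismPosition N r ψ d i)
      = !₂[-(2 * r * m * (Real.sin (k * Real.pi / (2 * N)) ^ 2 / w k)) * C
            - r * m * S * (Real.sin (k * (Real.pi / N)) / w k),
          -(2 * r * m * (Real.sin (k * Real.pi / (2 * N)) ^ 2 / w k)) * S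
            + r * m * C * (Real.sin (k * (Real.pi / N)) / w k),
          (-1) ^ i * (-(m * d / 2) * (((-1 : ℝ) ^ k - 1) ^ 2 / w k))] := fun k ↦ by
    have hsq : ((-1 : ℝ) ^ k) ^ 2 = 1 := by rw [← pow_mul, mul_comm, pow_mul]; simp
    ext a
    fin_cases a
    · simp [antiprismPosition, -Nat.cast_add, hang, Real.cos_add, hcos, ← hS, ← hC]
      ring
    · simp [antiprismPosition, -Nat.cast_add, hang, Real.sin_add, hcos, ← hS, ← hC]
      ring
    · simp [antiprismPosition, pow_add]
      linear_combination (-m * d / (2 * w k) * (-1) ^ i) * (-hsq)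
  rw [Finset.sum_congr rfl fun k _ ↦ hterm k]
  ext a
  fin_cases a
  · simp [Finset.sum_sub_distrib, ← Finset.mul_sum, ← Finset.sum_mul, hsum0, hF]
  · simp [Finset.sum_add_distrib, ← Finset.mul_sum, ← Finset.sum_mul, hsum0, hF]
  · simp [← Finset.mul_sum, hG]

theorem IsHipHopMotion.isNewtonSolution {N : ℕ} (hN : 0 < N) {m r₀ a b : ℝ} {r d θ : ℝ → ℝ}
    (h : IsHipHopMotion N m r₀ a b r d θ) : IsNewtonSolution m (antiprismBody N r d θ) := by
  have hpos : ∀ t, r t ≠ 0 := fun t ↦ (h.r_pos t).ne'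
  have hr : ∀ t, HasDerivAt r (deriv r t) t := fun t ↦ (h.differentiable_r t).hasDerivAt
  have hd : ∀ t, HasDerivAt d (deriv d t) t := fun t ↦ (h.differentiable_d t).hasDerivAt
  have hang : ∀ (j : Fin (2 * N)) t, HasDerivAt (fun s ↦ θ s + (j : ℕ) * (Real.pi / N))
      (a / r t ^ 2) t := fun j t ↦ (h.ode_θ t).add_const _
  have hq : ∀ j, antiprismBody N r d θ j
      = fun t ↦ antiprismPosition N (r t) (θ t) (d t) j := fun j ↦
    funext fun t ↦ antiprismBody_eq N r d θ j t
  have hv : ∀ (j : Fin (2 * N)) t, HasDerivAt (antiprismBody N r d θ j)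
      !₂[deriv r t * Real.cos (θ t + (j : ℕ) * (Real.pi / N))
          - a / r t * Real.sin (θ t + (j : ℕ) * (Real.pi / N)),
        deriv r t * Real.sin (θ t + (j : ℕ) * (Real.pi / N))
          + a / r t * Real.cos (θ t + (j : ℕ) * (Real.pi / N)),
        (-1) ^ (j : ℕ) * deriv d t] t := fun j t ↦ by
    have h0 := hpos t
    rw [hq]
    refine (hasDerivAt_vec3 ((hr t).mul (hang j t).cos) ((hr t).mul (hang j t).sin)
      ((hd t).const_mul ((-1) ^ (j : ℕ)))).congr_deriv ?_
    congr 1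
    ext k
    fin_cases k
    · simp; field_simp; ring
    · simp; field_simp
    · simp
  refine ⟨fun i j hij t ↦ ?_, fun j t ↦ (hv j t).differentiableAt, fun i t ↦ ?_⟩
  · rw [antiprismBody_eq, antiprismBody_eq]
    rcases lt_or_gt_of_ne (Fin.val_ne_of_ne hij) with h' | h'
    · exact antiprismPosition_ne (h.r_pos t) _ _ h' j.2
    · exact (antiprismPosition_ne (h.r_pos t) _ _ h' i.2).symm
  · have h0 := hpos t
    rw [Finset.sum_erase _ (by simp)]
    simp only [antiprismBody_eq]
    rw [Fin.sum_univ_eq_sum_range (fun k ↦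
      (m / ‖antiprismPosition N (r t) (θ t) (d t) k - antiprismPosition N (r t) (θ t) (d t) i‖ ^ 3)
        • (antiprismPosition N (r t) (θ t) (d t) k - antiprismPosition N (r t) (θ t) (d t) i)),
      sum_attraction_antiprismPosition hN, funext fun t ↦ (hv i t).deriv]
    have har : HasDerivAt (fun s ↦ a / r s) (-(a * deriv r t) / r t ^ 2) t := by
      convert! (hasDerivAt_const t a).div (hr t) h0 using 1
      simp
    refine (hasDerivAt_vec3 (((h.ode_r t).mul (hang i t).cos).sub (har.mul (hang i t).sin))
      (((h.ode_r t).mul (hang i t).sin).add (har.mul (hang i t).cos))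
      ((h.ode_d t).const_mul ((-1) ^ (i : ℕ)))).congr_deriv ?_
    congr 1
    ext k
    fin_cases k
    · simp; field_simp; ring
    · simp; field_simp; ring
    · simp

end

/-! ### The hip-hop branch -/

theorem theorem1 (N : ℕ) (hN : 1 < N) (m r₀ : ℝ) (hm : 0 < m) (hr₀ : 0 < r₀) :
    ∃ bhat : ℝ, 0 < bhat ∧ ∃ a T : ℝ → ℝ,
      a 0 = Real.sqrt (m * hipHopGamma N * r₀) ∧
      T 0 = Real.pi / 2 * Real.sqrt (r₀ ^ 3 / (m * hipHopAlpha N)) ∧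
      ContinuousOn a (Set.Ioo (-bhat) bhat) ∧
      ContinuousOn T (Set.Ioo (-bhat) bhat) ∧
      ∀ b ∈ Set.Ioo (-bhat) bhat,
        0 < T b ∧
        ∃ r d θ : ℝ → ℝ,
          -- `r = R(a(b), b, ·)`, `d = D(a(b), b, ·)`, `θ = Θ(a(b), b, ·)`
          IsHipHopMotion N m r₀ (a b) b r d θ ∧
          (∀ r' d' θ' : ℝ → ℝ, IsHipHopMotion N m r₀ (a b) b r' d' θ' →
            r' = r ∧ d' = d ∧ θ' = θ) ∧
          -- system (I) at time `T(b)`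
          deriv r (T b) = 0 ∧ deriv d (T b) = 0 ∧
          -- periodicity
          Function.Periodic r (4 * T b) ∧ Function.Periodic d (4 * T b) ∧
          -- double symmetry
          (∀ t, r (-t) = r t) ∧ (∀ t, d (-t) = -d t) ∧
          (∀ t, r (T b - t) = r (T b + t)) ∧ (∀ t, d (T b - t) = d (T b + t)) ∧
          -- the bodies form an antiprism at all times and obey Newton's law
          IsNewtonSolution m (antiprismBody N r d θ) ∧
          -- the branch starts at the planar circular solution
          (b = 0 → ∀ t, r t = r₀ ∧ d t = 0) := by
  have hα := hipHopAlpha_pos hN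
  have hγ := hipHopGamma_pos hN
  set ω := Real.sqrt (m * hipHopAlpha N / r₀ ^ 3) with hω_def
  set κ := Real.sqrt (m * hipHopGamma N / r₀ ^ 3) with hκ_def
  have hω : 0 < ω := Real.sqrt_pos.2 (by positivity)
  have hκ : 0 < κ := Real.sqrt_pos.2 (by positivity)
  have hω2 : ω ^ 2 = m * hipHopAlpha N / r₀ ^ 3 := Real.sq_sqrt (by positivity)
  have hκ2 : κ ^ 2 = m * hipHopGamma N / r₀ ^ 3 := Real.sq_sqrt (by positivity)
  have ha0 : κ * r₀ ^ 2 = Real.sqrt (m * hipHopGamma N * r₀) := by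
    rw [eq_comm, Real.sqrt_eq_iff_eq_sq (by positivity) (by positivity), mul_pow, hκ2]
    field_simp
  have hT0 : Real.sqrt (r₀ ^ 3 / (m * hipHopAlpha N)) = ω⁻¹ := by
    rw [hω_def, ← Real.sqrt_inv, inv_div]
  have hκω : κ < 2 * ω := by
    refine lt_of_pow_lt_pow_left₀ 2 (by positivity) ?_
    rw [mul_pow, hω2, hκ2, ← mul_div_assoc]
    rw [mul_left_comm]
    gcongr
    linarith [hipHopGamma_lt hN]
  obtain ⟨bhat, hbhat, a, T, ha, hT, hac, hTc, hbranch⟩ := exists_symmetric_branch (N := N) (m := m)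
    (T₀ := Real.pi / 2 * ω⁻¹) hr₀ hω hκ (by rw [hω2]; field_simp) (by rw [hκ2]; field_simp)
    (by field_simp) hκω
  refine ⟨bhat, hbhat, a, T, by rw [ha, ha0], by rw [hT, hT0], hac, hTc, fun b hb ↦ ?_⟩
  obtain ⟨hTb, x, hx0, hpos, hx, hp, hq, hs0, hs1⟩ := hbranch b hb
  obtain ⟨θ, hmot, hdr, hdd⟩ := exists_isHipHopMotion_of_rescaled hTb hx0 hpos hx
  have hTb0 := hTb.ne'
  have hneg : ∀ t, x (-t / T b) = reflectStart (x (t / T b)) := fun t ↦ by rw [neg_div, hs0]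
  have hquarter : ∀ t, x ((T b - t) / T b) = reflectQuarter (x ((T b + t) / T b)) := fun t ↦ by
    rw [← hs1]
    congr 1
    field_simp
    ring
  -- the two reflections compose to a translation by a half period, which reverses `d`
  have hhalf : ∀ s, x (s + 2) = reflectQuarter (reflectStart (x s)) := fun s ↦ by
    rw [← hs0, ← hs1, sub_neg_eq_add, add_comm]
  have hper : ∀ t, x ((t + 4 * T b) / T b) = x (t / T b) := fun t ↦ by
    rw [show (t + 4 * T b) / T b = t / T b + 2 + 2 by field_simp; ring, hhalf, hhalf]
    simp
  refine ⟨hTb, _, _, θ, hmot, fun r' d' θ' h' ↦ hmot.unique h', ?_, ?_, fun t ↦ ?_, fun t ↦ ?_,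
    fun t ↦ ?_, fun t ↦ ?_, fun t ↦ ?_, fun t ↦ ?_, hmot.isNewtonSolution (by omega), ?_⟩
  · rw [hdr]; simp [hTb0, hp]
  · rw [hdd]; simp [hTb0, hq]
  · simp only [hper]
  · simp only [hper]
  · simp [hneg]
  · simp [hneg]
  · simp [hquarter]
  · simp [hquarter]
  · rintro rfl t
    obtain ⟨θ₀, hcirc⟩ := exists_circular_isHipHopMotion (N := N) (m := m) (a := a 0) hr₀ (by
      rw [ha, ha0, Real.sq_sqrt (by positivity)])
    obtain ⟨h1, h2, -⟩ := hcirc.unique hmot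
    exact ⟨congrFun h1 t, congrFun h2 t⟩
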